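/- Let $\Bbbk$ be an algebraically closed field of characteristic zero and let $\xi\in\Bbbk$ be a primitive $4$-th root of unity. Let $\mathcal K$ be the Hopf algebra over $\Bbbk$ generated as an algebra by $a,b,c,d$ with relations $$ab=\xi ba,\quad ac=\xi ca,\quad cb=bc=0,\quad cd=\xi dc,\quad bd=\xi db,\quad ad=da=1,\quad b^2=c^2=0,\quad a^2c=b,\quad a^4=1,$$ with comultiplication $\Delta(a)=a\otimes a+b\otimes c$, $\Delta(b)=a\otimes b+b\otimes d$, $\Delta(c)=c\otimes a+d\otimes c$, $\Delta(d)=c\otimes b+d\otimes d$, counit $\varepsilon(a)=\varepsilon(d)=1$, $\varepsilon(b)=\varepsilon(c)=0$, and antipode $\mathcal S(a)=d$, $\mathcal S(b)=\xi b$, $\mathcal S(c)=-\xi c$, $\mathcal S(d)=a$. Let $V_{3,3}$ be the left Yetter--Drinfeld module over $\mathcal K$ with basis $e_1,e_2$, action $$a e_1=-\xi e_1,\quad a e_2=-e_2,\quad b e_1=c e_1=0,\quad b e_2=-e_1,\quad c e_2=e_1,\quad d e_1=\xi e_1,\quad d e_2=-e_2,$$ and coaction $\delta(e_1)=a\otimes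 e_1+(1+\xi)\,b\otimes e_2$, $\delta(e_2)=d\otimes e_2+\tfrac12(1-\xi)\,c\otimes e_1$. For a Yetter--Drinfeld module $V$ with braiding $c(u\otimes v)=u_{(-1)}\cdot v\otimes u_{(0)}$, the tensor algebra $T(V)$ is a braided Hopf algebra whose comultiplication $\Delta$ is the algebra map into the braided tensor product $T(V)\,\underline{\otimes}\,T(V)$ with $\Delta(v)=v\otimes 1+1\otimes v$ for $v\in V$. The Nichols algebra $\mathfrak B(V)$ is the quotient of $T(V)$ by the largest two-sided ideal $I$ that is generated by homogeneous elements of degree at least $2$ and satisfies $\Delta(I)\subseteq I\otimes T(V)+T(V)\otimes I$. Then $\mathfrak B(V_{3,3})$ is the algebra generated by $x=e_1$ and $y=e_2$ with defining relations $$x^2-2y^2=0,\qquad xy+yx=0,\qquad y^4=0.$$ That is, the algebra map from the free algebra $\Bbbk\langle x,y\rangle$ to $\mathfrak B(V_{3,3})$ with $x\mapsto e_1$, $y\mapsto e_2$ is surjective and its kernel is the two-sided ideal generated by $x^2-2y^2$, $xy+yx$ and $y^4$. Moreover $\dim_{\Bbbk}\mathfrak B(V_{3,3})=8$. -/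

import Mathlib

open scoped TensorProduct

set_option linter.unusedSimpArgs false
set_option linter.unusedSectionVars false

noncomputable section

/-! # The Hopf algebra `𝒦` -/

/-- The names of the four generators of the Hopf algebra `𝒦`. -/
inductive KGen : Type
  | a | b | c | d

namespace KHopf

variable {k : Type*} [Field k]

/-- The defining relations of the algebra `𝒦` (with parameter `ξ`) in the free algebra on
`a, b, c, d`. -/
inductive Rel (ξ : k) : FreeAlgebra k KGen → FreeAlgebra k KGen → Prop
  | ab : Rel ξ (FreeAlgebra.ι k .a * FreeAlgebra.ι k .b)
      (ξ • (FreeAlgebra.ι k .b * FreeAlgebra.ι k .a))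
  | ac : Rel ξ (FreeAlgebra.ι k .a * FreeAlgebra.ι k .c)
      (ξ • (FreeAlgebra.ι k .c * FreeAlgebra.ι k .a))
  | cb : Rel ξ (FreeAlgebra.ι k .c * FreeAlgebra.ι k .b) 0
  | bc : Rel ξ (FreeAlgebra.ι k .b * FreeAlgebra.ι k .c) 0
  | cd : Rel ξ (FreeAlgebra.ι k .c * FreeAlgebra.ι k .d)
      (ξ • (FreeAlgebra.ι k .d * FreeAlgebra.ι k .c))
  | bd : Rel ξ (FreeAlgebra.ι k .b * FreeAlgebra.ι k .d)
      (ξ • (FreeAlgebra.ι k .d * FreeAlgebra.ι k .b))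
  | ad_da : Rel ξ (FreeAlgebra.ι k .a * FreeAlgebra.ι k .d)
      (FreeAlgebra.ι k .d * FreeAlgebra.ι k .a)
  | ad : Rel ξ (FreeAlgebra.ι k .a * FreeAlgebra.ι k .d) 1
  | bb : Rel ξ (FreeAlgebra.ι k .b ^ 2) 0
  | cc : Rel ξ (FreeAlgebra.ι k .c ^ 2) 0
  | aac : Rel ξ (FreeAlgebra.ι k .a ^ 2 * FreeAlgebra.ι k .c) (FreeAlgebra.ι k .b)
  | aaaa : Rel ξ (FreeAlgebra.ι k .a ^ 4) 1

end KHopf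

/-- The algebra `𝒦`: generators `a, b, c, d`, relations `ab = ξba`, `ac = ξca`, `cb = 0 = bc`,
`cd = ξdc`, `bd = ξdb`, `ad = da`, `ad = 1`, `b² = 0 = c²`, `a²c = b`, `a⁴ = 1`. -/
def KAlg {k : Type*} [Field k] (ξ : k) : Type _ := RingQuot (KHopf.Rel ξ)

namespace KHopf

variable {k : Type*} [Field k] (ξ : k)

instance : Ring (KAlg ξ) := inferInstanceAs (Ring (RingQuot (Rel ξ)))

instance : Algebra k (KAlg ξ) := inferInstanceAs (Algebra k (RingQuot (Rel ξ)))

/-- The generators of `𝒦`. -/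
def gen (i : KGen) : KAlg ξ := RingQuot.mkAlgHom k (Rel ξ) (FreeAlgebra.ι k i)

lemma gen_ab : gen ξ .a * gen ξ .b = ξ • (gen ξ .b * gen ξ .a) := by
  simpa [gen] using! RingQuot.mkAlgHom_rel k (Rel.ab (ξ := ξ))

lemma gen_ac : gen ξ .a * gen ξ .c = ξ • (gen ξ .c * gen ξ .a) := by
  simpa [gen] using! RingQuot.mkAlgHom_rel k (Rel.ac (ξ := ξ))

lemma gen_cb : gen ξ .c * gen ξ .b = 0 := by
  simpa [gen] using! RingQuot.mkAlgHom_rel k (Rel.cb (ξ := ξ))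

lemma gen_bc : gen ξ .b * gen ξ .c = 0 := by
  simpa [gen] using! RingQuot.mkAlgHom_rel k (Rel.bc (ξ := ξ))

lemma gen_cd : gen ξ .c * gen ξ .d = ξ • (gen ξ .d * gen ξ .c) := by
  simpa [gen] using! RingQuot.mkAlgHom_rel k (Rel.cd (ξ := ξ))

lemma gen_bd : gen ξ .b * gen ξ .d = ξ • (gen ξ .d * gen ξ .b) := by
  simpa [gen] using! RingQuot.mkAlgHom_rel k (Rel.bd (ξ := ξ))

lemma gen_ad : gen ξ .a * gen ξ .d = 1 := by
  simpa [gen] using! RingQuot.mkAlgHom_rel k (Rel.ad (ξ := ξ))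

lemma gen_da : gen ξ .d * gen ξ .a = 1 := by
  rw [← gen_ad]
  simpa [gen] using! (RingQuot.mkAlgHom_rel k (Rel.ad_da (ξ := ξ))).symm

lemma gen_bb : gen ξ .b * gen ξ .b = 0 := by
  simpa [gen, pow_two] using! RingQuot.mkAlgHom_rel k (Rel.bb (ξ := ξ))

lemma gen_cc : gen ξ .c * gen ξ .c = 0 := by
  simpa [gen, pow_two] using! RingQuot.mkAlgHom_rel k (Rel.cc (ξ := ξ))

lemma gen_aac : gen ξ .a * gen ξ .a * gen ξ .c = gen ξ .b := by
  simpa [gen, pow_two] using! RingQuot.mkAlgHom_rel k (Rel.aac (ξ := ξ))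

lemma gen_aaaa : gen ξ .a ^ 4 = 1 := by
  simpa [gen] using! RingQuot.mkAlgHom_rel k (Rel.aaaa (ξ := ξ))

/-- `𝒦` has the universal property of the algebra presented by generators and relations. -/
def lift {A : Type*} [Ring A] [Algebra k A] (f : KGen → A)
    (h : ∀ ⦃x y⦄, Rel ξ x y → FreeAlgebra.lift k f x = FreeAlgebra.lift k f y) :
    KAlg ξ →ₐ[k] A :=
  RingQuot.liftAlgHom k ⟨FreeAlgebra.lift k f, h⟩

@[simp]
lemma lift_gen {A : Type*} [Ring A] [Algebra k A] (f : KGen → A)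
    (h : ∀ ⦃x y⦄, Rel ξ x y → FreeAlgebra.lift k f x = FreeAlgebra.lift k f y) (i : KGen) :
    lift ξ f h (gen ξ i) = f i :=
  (RingQuot.liftAlgHom_mkAlgHom_apply k _ h (FreeAlgebra.ι k i)).trans
    (FreeAlgebra.lift_ι_apply f i)

variable {ξ} in
lemma algHom_ext {A : Type*} [Semiring A] [Algebra k A] {f g : KAlg ξ →ₐ[k] A}
    (h : ∀ i, f (gen ξ i) = g (gen ξ i)) : f = g := by
  refine RingQuot.ringQuot_ext' k f g (FreeAlgebra.hom_ext (funext fun i => ?_))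
  exact h i

variable {ξ} in
/-- Induction principle: `𝒦` is generated as an algebra by `a, b, c, d`. -/
lemma induction_on {P : KAlg ξ → Prop} (x : KAlg ξ) (hs : ∀ r : k, P (algebraMap k _ r))
    (hg : ∀ i, P (gen ξ i)) (hm : ∀ x y, P x → P y → P (x * y))
    (ha : ∀ x y, P x → P y → P (x + y)) : P x := by
  obtain ⟨y, rfl⟩ := RingQuot.mkAlgHom_surjective k (Rel ξ) x
  induction y using FreeAlgebra.induction with
  | grade0 r => simpa using! hs r
  | grade1 i => exact hg i
  | mul a b ha hb => rw [map_mul]; exact hm _ _ ha hb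
  | add a b h₁ h₂ => rw [map_add]; exact ha _ _ h₁ h₂

/-- The comultiplication of `𝒦` on the generators. -/
def comulGen : KGen → KAlg ξ ⊗[k] KAlg ξ
  | .a => gen ξ .a ⊗ₜ gen ξ .a + gen ξ .b ⊗ₜ gen ξ .c
  | .b => gen ξ .a ⊗ₜ gen ξ .b + gen ξ .b ⊗ₜ gen ξ .d
  | .c => gen ξ .c ⊗ₜ gen ξ .a + gen ξ .d ⊗ₜ gen ξ .c
  | .d => gen ξ .c ⊗ₜ gen ξ .b + gen ξ .d ⊗ₜ gen ξ .d

/-- The counit of `𝒦` on the generators. -/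
def counitGen : KGen → k
  | .a => 1
  | .b => 0
  | .c => 0
  | .d => 1

/-- The antipode of `𝒦` on the generators. -/
def antipodeGen : KGen → KAlg ξ
  | .a => gen ξ .d
  | .b => ξ • gen ξ .b
  | .c => -(ξ • gen ξ .c)
  | .d => gen ξ .a

lemma gen_aaa : gen ξ .a * gen ξ .a * gen ξ .a = gen ξ .d := by
  have h : gen ξ .a * gen ξ .a * gen ξ .a * (gen ξ .a * gen ξ .d) = gen ξ .d := by
    rw [← mul_assoc, ← pow_three', ← pow_succ, gen_aaaa, one_mul]
  simpa [gen_ad] using h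

lemma gen_aad : gen ξ .a * gen ξ .a * gen ξ .d = gen ξ .a := by
  rw [mul_assoc, gen_ad, mul_one]

lemma gen_db : gen ξ .d * gen ξ .b = ξ • (gen ξ .c * gen ξ .a) := by
  rw [← gen_ac, ← gen_aac, ← mul_assoc, ← mul_assoc, gen_da, one_mul]

lemma gen_dc : gen ξ .d * gen ξ .c = ξ • (gen ξ .b * gen ξ .a) := by
  rw [← gen_ab, ← gen_aac, ← gen_aaa]
  simp only [mul_assoc]

variable {ξ} in
lemma xi_mul_xi (h : IsPrimitiveRoot ξ 4) : ξ * ξ = -1 := by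
  have h2 : (ξ ^ 2) ^ 2 = 1 := by rw [← pow_mul]; exact h.pow_eq_one
  have h3 : ξ ^ 2 ≠ 1 := fun h4 => absurd (h.dvd_of_pow_eq_one 2 h4) (by decide)
  rw [← pow_two]
  exact (sq_eq_one_iff.1 h2).resolve_left h3

/-- The comultiplication of `𝒦` as an algebra map. -/
def comulHom (hξ : IsPrimitiveRoot ξ 4) : KAlg ξ →ₐ[k] KAlg ξ ⊗[k] KAlg ξ :=
  lift ξ (comulGen ξ) (by
    have hx := xi_mul_xi hξ
    have haa : comulGen ξ .a * comulGen ξ .a =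
        (gen ξ .a * gen ξ .a) ⊗ₜ (gen ξ .a * gen ξ .a) := by
      simp [comulGen, mul_add, add_mul, gen_bb, gen_cc, gen_ab, gen_ac, TensorProduct.smul_tmul',
        TensorProduct.tmul_smul, smul_smul, hx,
        TensorProduct.neg_tmul]
    rintro x y (_ | _)
    case aaaa =>
      simp only [map_pow, map_one, FreeAlgebra.lift_ι_apply]
      rw [show 4 = 2 * 2 from rfl, pow_mul, pow_two (comulGen ξ .a), haa,
        Algebra.TensorProduct.tmul_pow, ← pow_two, ← pow_mul, gen_aaaa,
        Algebra.TensorProduct.one_def]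
    case aac =>
      simp only [map_pow, map_mul, FreeAlgebra.lift_ι_apply]
      rw [pow_two, haa]
      simp [comulGen, mul_add, gen_aac, gen_aaa, gen_aad, add_comm]
    all_goals
      simp [comulGen, mul_add, add_mul, pow_two, gen_bb, gen_cc, gen_ab, gen_ac, gen_cb, gen_bc,
        gen_cd, gen_bd, gen_db, gen_dc, gen_ad, gen_da, TensorProduct.smul_tmul',
        TensorProduct.tmul_smul, smul_smul, hx, Algebra.TensorProduct.one_def,
        TensorProduct.neg_tmul, TensorProduct.tmul_neg, add_comm])

/-- The counit of `𝒦` as an algebra map. -/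
def counitHom : KAlg ξ →ₐ[k] k :=
  lift ξ counitGen (by
    rintro x y (_ | _) <;> simp [counitGen])

/-- The antipode of `𝒦` as an algebra map to the opposite algebra. -/
def antipodeHom (hξ : IsPrimitiveRoot ξ 4) : KAlg ξ →ₐ[k] (KAlg ξ)ᵐᵒᵖ :=
  lift ξ (fun i => MulOpposite.op (antipodeGen ξ i)) (by
    have hx := xi_mul_xi hξ
    rintro x y (_ | _) <;>
      simp only [map_pow, map_mul, map_one, map_smul, map_zero, FreeAlgebra.lift_ι_apply] <;>
      apply MulOpposite.unop_injective <;>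
      simp [antipodeGen]
    case aac =>
      rw [pow_two, ← mul_assoc, gen_cd, gen_dc, smul_mul_assoc, smul_mul_assoc, mul_assoc, gen_ad,
        smul_smul, hx]
      simp
    case aaaa =>
      have h : Commute (gen ξ .d) (gen ξ .a) := (gen_da ξ).trans (gen_ad ξ).symm
      have h4 := h.mul_pow 4
      rwa [gen_da, gen_aaaa, one_pow, mul_one, eq_comm] at h4
    all_goals simp [gen_bb, gen_cc, gen_ab, gen_ac, gen_cb, gen_bc,
        gen_cd, gen_bd, gen_ad, gen_da, smul_pow, pow_two])

@[simp] lemma comulHom_gen (hξ : IsPrimitiveRoot ξ 4) (i : KGen) :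
    comulHom ξ hξ (gen ξ i) = comulGen ξ i := lift_gen ..

@[simp] lemma counitHom_gen (i : KGen) : counitHom ξ (gen ξ i) = counitGen i := lift_gen ..

@[simp] lemma antipodeHom_gen (hξ : IsPrimitiveRoot ξ 4) (i : KGen) :
    antipodeHom ξ hξ (gen ξ i) = MulOpposite.op (antipodeGen ξ i) := lift_gen ..

/-- The bialgebra structure of `𝒦`. -/
instance [hξ : Fact (IsPrimitiveRoot ξ 4)] : Bialgebra k (KAlg ξ) :=
  Bialgebra.ofAlgHom (comulHom ξ hξ.out) (counitHom ξ)
    (algHom_ext fun i => by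
      cases i <;> simp [comulGen, TensorProduct.add_tmul, TensorProduct.tmul_add] <;> abel)
    (algHom_ext fun i => by cases i <;> simp [comulGen, counitGen])
    (algHom_ext fun i => by cases i <;> simp [comulGen, counitGen])

section

variable [hξ : Fact (IsPrimitiveRoot ξ 4)]

lemma comul_gen (i : KGen) : Coalgebra.comul (R := k) (gen ξ i) = comulGen ξ i :=
  comulHom_gen ξ hξ.out i

lemma counit_gen (i : KGen) : Coalgebra.counit (R := k) (gen ξ i) = counitGen i :=
  counitHom_gen ξ i

/-- The antipode of `𝒦`: the anti-multiplicative map given by `antipodeGen` on generators. -/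
def antipodeLin : KAlg ξ →ₗ[k] KAlg ξ :=
  (MulOpposite.opLinearEquiv k).symm.toLinearMap ∘ₗ (antipodeHom ξ hξ.out).toLinearMap

@[simp] lemma antipodeLin_gen (i : KGen) : antipodeLin ξ (gen ξ i) = antipodeGen ξ i := by
  simp [antipodeLin]

@[simp] lemma antipodeLin_one : antipodeLin ξ (1 : KAlg ξ) = 1 := by
  simp [antipodeLin]

@[simp] lemma antipodeLin_mul (x y : KAlg ξ) :
    antipodeLin ξ (x * y) = antipodeLin ξ y * antipodeLin ξ x := by
  simp [antipodeLin]

lemma antipode_left_mul (X Y : KAlg ξ ⊗[k] KAlg ξ) (r : k)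
    (hX : LinearMap.mul' k _ ((antipodeLin ξ).rTensor _ X) = algebraMap k _ r) :
    LinearMap.mul' k _ ((antipodeLin ξ).rTensor _ (X * Y)) =
      algebraMap k _ r * LinearMap.mul' k _ ((antipodeLin ξ).rTensor _ Y) := by
  induction Y with
  | zero => simp
  | add Y₁ Y₂ h₁ h₂ => simp only [mul_add, map_add, h₁, h₂]
  | tmul s t =>
    have key : ∀ Z : KAlg ξ ⊗[k] KAlg ξ,
        LinearMap.mul' k _ ((antipodeLin ξ).rTensor _ (Z * (s ⊗ₜ t))) =
          antipodeLin ξ s * LinearMap.mul' k _ ((antipodeLin ξ).rTensor _ Z) * t := by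
      intro Z
      induction Z with
      | zero => simp
      | add Z₁ Z₂ h₁ h₂ => simp only [add_mul, mul_add, map_add, h₁, h₂]
      | tmul p q => simp [mul_assoc]
    rw [key, hX, ← Algebra.commutes r, mul_assoc]
    simp

lemma antipode_right_mul (X Y : KAlg ξ ⊗[k] KAlg ξ) (r : k)
    (hY : LinearMap.mul' k _ ((antipodeLin ξ).lTensor _ Y) = algebraMap k _ r) :
    LinearMap.mul' k _ ((antipodeLin ξ).lTensor _ (X * Y)) =
      LinearMap.mul' k _ ((antipodeLin ξ).lTensor _ X) * algebraMap k _ r := by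
  induction X with
  | zero => simp
  | add X₁ X₂ h₁ h₂ => simp only [add_mul, map_add, h₁, h₂]
  | tmul s t =>
    have key : ∀ Z : KAlg ξ ⊗[k] KAlg ξ,
        LinearMap.mul' k _ ((antipodeLin ξ).lTensor _ ((s ⊗ₜ t) * Z)) =
          s * LinearMap.mul' k _ ((antipodeLin ξ).lTensor _ Z) * antipodeLin ξ t := by
      intro Z
      induction Z with
      | zero => simp
      | add Z₁ Z₂ h₁ h₂ => simp only [add_mul, mul_add, map_add, h₁, h₂]
      | tmul p q => simp [mul_assoc]
    rw [key, hY, mul_assoc, Algebra.commutes r, ← mul_assoc]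
    simp

/-- The Hopf algebra structure of `𝒦`. -/
instance : HopfAlgebra k (KAlg ξ) where
  antipode := antipodeLin ξ
  mul_antipode_rTensor_comul := by
    have hx := xi_mul_xi hξ.out
    ext x
    simp only [LinearMap.comp_apply, Algebra.linearMap_apply]
    induction x using induction_on with
    | hs r => simp [Algebra.algebraMap_eq_smul_one, Algebra.TensorProduct.one_def]
    | hg i =>
      rw [comul_gen, counit_gen]
      cases i <;> simp [comulGen, counitGen, antipodeGen, gen_bb, gen_cc, gen_ab, gen_ac, gen_cb,
        gen_bc, gen_cd, gen_bd, gen_db, gen_dc, gen_ad, gen_da, smul_smul, hx]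
    | hm x y h₁ h₂ => rw [Bialgebra.comul_mul, antipode_left_mul ξ _ _ _ h₁, h₂,
        Bialgebra.counit_mul, map_mul]
    | ha x y h₁ h₂ => simp only [map_add, h₁, h₂]
  mul_antipode_lTensor_comul := by
    have hx := xi_mul_xi hξ.out
    ext x
    simp only [LinearMap.comp_apply, Algebra.linearMap_apply]
    induction x using induction_on with
    | hs r => simp [Algebra.algebraMap_eq_smul_one, Algebra.TensorProduct.one_def]
    | hg i =>
      rw [comul_gen, counit_gen]
      cases i <;> simp [comulGen, counitGen, antipodeGen, gen_bb, gen_cc, gen_ab, gen_ac, gen_cb,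
        gen_bc, gen_cd, gen_bd, gen_db, gen_dc, gen_ad, gen_da, smul_smul, hx]
    | hm x y h₁ h₂ => rw [Bialgebra.comul_mul, antipode_right_mul ξ _ _ _ h₂, h₁,
        Bialgebra.counit_mul, map_mul]
    | ha x y h₁ h₂ => simp only [map_add, h₁, h₂]

lemma antipode_gen (i : KGen) : HopfAlgebra.antipode k (gen ξ i) = antipodeGen ξ i :=
  antipodeLin_gen ξ i

end

end KHopf

/-! # Yetter–Drinfeld modules and Nichols algebras -/

section YetterDrinfeld

variable {k H : Type*} [Field k] [Ring H] [HopfAlgebra k H]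

/-- For an action of `H` on `V`, the linear map sending `h₁ ⊗ h₂ ⊗ h₃` to the endomorphism
`x ⊗ v ↦ h₁ x S(h₃) ⊗ h₂ · v` of `H ⊗ V`. -/
def ydTwist {V : Type*} [AddCommGroup V] [Module k V] (act : H →ₐ[k] Module.End k V) :
    H ⊗[k] (H ⊗[k] H) →ₗ[k] Module.End k (H ⊗[k] V) :=
  TensorProduct.homTensorHomMap (RingHom.id k) H V H V ∘ₗ
    TensorProduct.map
      (TensorProduct.lift (LinearMap.mk₂ k
        (fun x y => LinearMap.mulLeft k x ∘ₗ LinearMap.mulRight k (HopfAlgebra.antipode k y))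
        (by intros; ext; simp [add_mul]) (by intros; ext; simp)
        (by intros; ext; simp [mul_add]) (by intros; ext; simp)))
      act.toLinearMap ∘ₗ
    (TensorProduct.assoc k H H H).symm.toLinearMap ∘ₗ
    (TensorProduct.comm k H H).toLinearMap.lTensor H

@[simp]
lemma ydTwist_tmul {V : Type*} [AddCommGroup V] [Module k V] (act : H →ₐ[k] Module.End k V)
    (h₁ h₂ h₃ x : H) (v : V) :
    ydTwist act (h₁ ⊗ₜ (h₂ ⊗ₜ h₃)) (x ⊗ₜ v) =
      (h₁ * (x * HopfAlgebra.antipode k h₃)) ⊗ₜ act h₂ v := by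
  simp [ydTwist]

variable (k H) in
/-- A left Yetter–Drinfeld module structure over the Hopf algebra `H` on the vector space `V`:
a left action, a left coaction `δ`, and the compatibility
`δ(h · v) = h₁ v₍₋₁₎ S(h₃) ⊗ h₂ · v₍₀₎`. -/
structure YetterDrinfeldModule (V : Type*) [AddCommGroup V] [Module k V] where
  /-- The action of `H`. -/
  act : H →ₐ[k] Module.End k V
  /-- The coaction of `H`. -/
  coact : V →ₗ[k] H ⊗[k] V
  counit_coact : ∀ v, TensorProduct.lid k V
    ((Coalgebra.counit (R := k) (A := H)).rTensor V (coact v)) = v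
  coassoc : ∀ v, TensorProduct.assoc k H H V
    ((Coalgebra.comul (R := k) (A := H)).rTensor V (coact v)) = coact.lTensor H (coact v)
  coact_act : ∀ h v, coact (act h v) =
    ydTwist act ((Coalgebra.comul (R := k) (A := H)).lTensor H (Coalgebra.comul (R := k) h))
      (coact v)

namespace YetterDrinfeldModule

variable {V : Type*} [AddCommGroup V] [Module k V] (M : YetterDrinfeldModule k H V)

/-- The action of `H` on the tensor algebra `T(V)` for which `T(V)` is a module algebra, as a map
into the convolution algebra of linear maps `H → T(V)`; it sends `t` to `h ↦ h · t`. -/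
def tensorActHom : TensorAlgebra k V →ₐ[k] WithConv (H →ₗ[k] TensorAlgebra k V) :=
  TensorAlgebra.lift k
    ((WithConv.linearEquiv k (H →ₗ[k] TensorAlgebra k V)).symm.toLinearMap ∘ₗ
      (TensorAlgebra.ι k).compRight k ∘ₗ M.act.toLinearMap.flip)

/-- The action of `H` on `T(V)`: the diagonal action on each `V ⊗ ⋯ ⊗ V`. -/
def tensorAct : H →ₗ[k] TensorAlgebra k V →ₗ[k] TensorAlgebra k V :=
  ((WithConv.linearEquiv k (H →ₗ[k] TensorAlgebra k V)).toLinearMap ∘ₗ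
    M.tensorActHom.toLinearMap).flip

lemma tensorAct_ι (h : H) (v : V) :
    M.tensorAct h (TensorAlgebra.ι k v) = TensorAlgebra.ι k (M.act h v) := by
  simp [tensorAct, tensorActHom]

lemma tensorAct_one (h : H) :
    M.tensorAct h 1 = algebraMap k _ (Coalgebra.counit (R := k) h) := by
  simp [tensorAct]

/-- The module algebra law `h · (s t) = (h₁ · s) (h₂ · t)`. -/
lemma tensorAct_mul (h : H) (s t : TensorAlgebra k V) :
    M.tensorAct h (s * t) = LinearMap.mul' k _
      (TensorProduct.map (M.tensorAct.flip s) (M.tensorAct.flip t)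
        (Coalgebra.comul (R := k) h)) := by
  simp only [tensorAct, LinearMap.flip_apply, LinearMap.comp_apply, AlgHom.toLinearMap_apply,
    map_mul]
  rfl

/-- The coaction of `H` on `T(V)`: the algebra map extending the coaction on `V`. -/
def tensorCoact : TensorAlgebra k V →ₐ[k] H ⊗[k] TensorAlgebra k V :=
  TensorAlgebra.lift k ((TensorAlgebra.ι k).lTensor H ∘ₗ M.coact)

/-- The braiding `s ⊗ t ↦ s₍₋₁₎ · t ⊗ s₍₀₎` of `T(V)` with itself. -/
def tensorBraiding : TensorAlgebra k V ⊗[k] TensorAlgebra k V →ₗ[k]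
    TensorAlgebra k V ⊗[k] TensorAlgebra k V :=
  (TensorProduct.lift M.tensorAct).rTensor _ ∘ₗ
    (TensorProduct.assoc k H _ _).symm.toLinearMap ∘ₗ
    (TensorProduct.comm k _ _).toLinearMap.lTensor H ∘ₗ
    (TensorProduct.assoc k H _ _).toLinearMap ∘ₗ
    M.tensorCoact.toLinearMap.rTensor _

/-- The multiplication of the braided tensor product algebra `T(V) ⊗ T(V)`:
`(r ⊗ s) (r' ⊗ s') = r (s₍₋₁₎ · r') ⊗ s₍₀₎ s'`. -/
def braidedMul : TensorAlgebra k V ⊗[k] TensorAlgebra k V →ₗ[k]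
    TensorAlgebra k V ⊗[k] TensorAlgebra k V →ₗ[k]
    TensorAlgebra k V ⊗[k] TensorAlgebra k V :=
  TensorProduct.curry
    (TensorProduct.map (LinearMap.mul' k _) (LinearMap.mul' k _) ∘ₗ
      (TensorProduct.tensorTensorTensorAssoc k _ _ _ _).symm.toLinearMap ∘ₗ
      (M.tensorBraiding.lTensor _).rTensor _ ∘ₗ
      (TensorProduct.tensorTensorTensorAssoc k _ _ _ _).toLinearMap)

/-- The comultiplication of the braided Hopf algebra `T(V)`: the multiplicative map into the
braided tensor product algebra with `Δ(v) = v ⊗ 1 + 1 ⊗ v` for `v ∈ V`. Explicitly,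
`Δ(v₁ ⋯ vₙ) = Δ(v₁) (Δ(v₂) ( ⋯ (Δ(vₙ) (1 ⊗ 1))))`, with products taken by `braidedMul`. -/
def braidedComul : TensorAlgebra k V →ₗ[k] TensorAlgebra k V ⊗[k] TensorAlgebra k V :=
  (TensorAlgebra.lift k (A := Module.End k (TensorAlgebra k V ⊗[k] TensorAlgebra k V))
    (M.braidedMul ∘ₗ
      ((TensorProduct.mk k _ _).flip 1 + TensorProduct.mk k _ _ 1) ∘ₗ
        TensorAlgebra.ι k)).toLinearMap.flip (1 ⊗ₜ 1)

lemma braidedComul_one : M.braidedComul 1 = 1 ⊗ₜ 1 := by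
  simp [braidedComul]

lemma braidedComul_ι_mul (v : V) (t : TensorAlgebra k V) :
    M.braidedComul (TensorAlgebra.ι k v * t) =
      M.braidedMul (TensorAlgebra.ι k v ⊗ₜ 1 + 1 ⊗ₜ TensorAlgebra.ι k v) (M.braidedComul t) := by
  simp [braidedComul]

/-- The homogeneous component `Tⁿ(V)` of the tensor algebra. -/
def tensorDegree (k V : Type*) [Field k] [AddCommGroup V] [Module k V] (n : ℕ) :
    Submodule k (TensorAlgebra k V) :=
  LinearMap.range (TensorAlgebra.ι k : V →ₗ[k] TensorAlgebra k V) ^ n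

/-- The underlying subspace of a two-sided ideal of an algebra. -/
def idealSubmodule {A : Type*} [Ring A] [Algebra k A] (I : TwoSidedIdeal A) : Submodule k A :=
  (TwoSidedIdeal.asIdeal I).restrictScalars k

/-- The homogeneous two-sided ideals `I` of `T(V)` that are generated by homogeneous elements of
degree at least two and satisfy `Δ(I) ⊆ I ⊗ T(V) + T(V) ⊗ I`. -/
def coidealIdeals : Set (TwoSidedIdeal (TensorAlgebra k V)) :=
  {I | (∃ S : Set (TensorAlgebra k V),
      (∀ s ∈ S, ∃ n, 2 ≤ n ∧ s ∈ tensorDegree k V n) ∧ I = TwoSidedIdeal.span S) ∧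
    ∀ t ∈ I, M.braidedComul t ∈
      LinearMap.range ((idealSubmodule (k := k) I).subtype.rTensor (TensorAlgebra k V)) ⊔
      LinearMap.range ((idealSubmodule (k := k) I).subtype.lTensor (TensorAlgebra k V))}

/-- The defining ideal of the Nichols algebra. -/
def nicholsIdeal : TwoSidedIdeal (TensorAlgebra k V) := sSup M.coidealIdeals

/-- `nicholsIdeal` is the largest ideal in `coidealIdeals`. -/
lemma isGreatest_nicholsIdeal : IsGreatest M.coidealIdeals M.nicholsIdeal := by
  refine ⟨⟨⟨{s | s ∈ M.nicholsIdeal ∧ ∃ n, 2 ≤ n ∧ s ∈ tensorDegree k V n},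
    fun s hs => hs.2, le_antisymm (sSup_le ?_) (TwoSidedIdeal.span_le.2 fun s hs => hs.1)⟩, ?_⟩,
    fun I hI => le_sSup hI⟩
  · intro I hI
    obtain ⟨⟨S, hS, rfl⟩, -⟩ := id hI
    exact TwoSidedIdeal.span_mono fun s hs =>
      ⟨(show TwoSidedIdeal.span S ≤ M.nicholsIdeal from le_sSup hI) (TwoSidedIdeal.subset_span hs),
        hS s hs⟩
  · let N : Submodule k (TensorAlgebra k V) := ⨆ I ∈ M.coidealIdeals, idealSubmodule I
    have hle : ∀ I ∈ M.coidealIdeals, idealSubmodule (k := k) I ≤ N := fun I hI =>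
      le_iSup₂_of_le (f := fun I (_ : I ∈ M.coidealIdeals) => idealSubmodule I) I hI le_rfl
    have hmul : ∀ f : TensorAlgebra k V →ₗ[k] TensorAlgebra k V,
        (∀ I : TwoSidedIdeal (TensorAlgebra k V), ∀ x ∈ I, f x ∈ I) → ∀ x ∈ N, f x ∈ N := by
      intro f hf
      suffices h : N ≤ N.comap f from h
      refine iSup₂_le fun I hI x hx => hle I hI ?_
      exact hf I x hx
    let J : TwoSidedIdeal (TensorAlgebra k V) := .mk' (N : Set (TensorAlgebra k V))
      N.zero_mem N.add_mem N.neg_mem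
      (fun {x y} hy => hmul (LinearMap.mulLeft k x) (fun I z hz => I.mul_mem_left x z hz) y hy)
      (fun {x y} hx => hmul (LinearMap.mulRight k y) (fun I z hz => I.mul_mem_right z y hz) x hx)
    have hJ : M.nicholsIdeal ≤ J := sSup_le fun I hI x hx =>
      (TwoSidedIdeal.mem_mk' _ _ _ _ _ _ x).2 (hle I hI hx)
    intro t ht
    have htN : t ∈ N := (TwoSidedIdeal.mem_mk' _ _ _ _ _ _ t).1 (hJ ht)
    suffices h : N ≤ Submodule.comap M.braidedComul
        (LinearMap.range ((idealSubmodule (k := k) M.nicholsIdeal).subtype.rTensor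
            (TensorAlgebra k V)) ⊔
          LinearMap.range ((idealSubmodule (k := k) M.nicholsIdeal).subtype.lTensor
            (TensorAlgebra k V))) from h htN
    refine iSup₂_le fun I hI x hx => ?_
    have hIJ : idealSubmodule (k := k) I ≤ idealSubmodule (k := k) M.nicholsIdeal :=
      fun y hy => (show I ≤ M.nicholsIdeal from le_sSup hI) hy
    have h₁ : LinearMap.range ((idealSubmodule (k := k) I).subtype.rTensor (TensorAlgebra k V)) ≤
        LinearMap.range ((idealSubmodule (k := k) M.nicholsIdeal).subtype.rTensor
          (TensorAlgebra k V)) := by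
      rw [← Submodule.subtype_comp_inclusion _ _ hIJ, LinearMap.rTensor_comp]
      exact LinearMap.range_comp_le_range _ _
    have h₂ : LinearMap.range ((idealSubmodule (k := k) I).subtype.lTensor (TensorAlgebra k V)) ≤
        LinearMap.range ((idealSubmodule (k := k) M.nicholsIdeal).subtype.lTensor
          (TensorAlgebra k V)) := by
      rw [← Submodule.subtype_comp_inclusion _ _ hIJ, LinearMap.lTensor_comp]
      exact LinearMap.range_comp_le_range _ _
    exact sup_le_sup h₁ h₂ (hI.2 x hx)

/-- The Nichols algebra of a Yetter–Drinfeld module `V`: the quotient of the tensor algebra `T(V)`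
by the largest two-sided ideal in `coidealIdeals`. -/
abbrev NicholsAlgebra : Type _ := TensorAlgebra k V ⧸ TwoSidedIdeal.asIdeal M.nicholsIdeal

/-- The canonical map from `V` to its Nichols algebra. -/
def nicholsι : V →ₗ[k] M.NicholsAlgebra :=
  (Ideal.Quotient.mkₐ k (TwoSidedIdeal.asIdeal M.nicholsIdeal)).toLinearMap ∘ₗ TensorAlgebra.ι k

end YetterDrinfeldModule

end YetterDrinfeld

/-! # The Yetter–Drinfeld module `V_{3,3}` over `𝒦` -/

namespace KHopf

variable {k : Type*} [Field k] (ξ : k) [hξ : Fact (IsPrimitiveRoot ξ 4)]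

/-- The matrices of `a, b, c, d` acting on `V_{3,3}` in the basis `e₁, e₂`. With `λ₁ = ξ³ = -ξ`:
`a e₁ = λ₁ e₁`, `a e₂ = -ξ λ₁ e₂`, `b e₁ = c e₁ = 0`, `b e₂ = λ₁² e₁`, `c e₂ = e₁`,
`d e₁ = λ₁⁻¹ e₁`, `d e₂ = ξ λ₁⁻¹ e₂`. -/
def v33Matrix : KGen → Matrix (Fin 2) (Fin 2) k
  | .a => !![-ξ, 0; 0, -1]
  | .b => !![0, -1; 0, 0]
  | .c => !![0, 1; 0, 0]
  | .d => !![ξ, 0; 0, -1]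

/-- The action of `𝒦` on `V_{3,3}`. -/
def v33Act (hξ : IsPrimitiveRoot ξ 4) : KAlg ξ →ₐ[k] Module.End k (Fin 2 → k) :=
  (Matrix.toLinAlgEquiv' (R := k) (n := Fin 2)).toAlgHom.comp (lift ξ (v33Matrix ξ) (by
    have hx := xi_mul_xi hξ
    have ha : v33Matrix ξ .a ^ 2 = !![-1, 0; 0, 1] := by
      simp [v33Matrix, pow_two, hx]
    rintro x y (_ | _)
    case aaaa =>
      simp only [map_pow, map_one, FreeAlgebra.lift_ι_apply]
      rw [show 4 = 2 * 2 from rfl, pow_mul, ha]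
      simp [pow_two, Matrix.one_fin_two]
    case aac =>
      simp only [map_pow, map_mul, FreeAlgebra.lift_ι_apply]
      rw [ha]
      simp [v33Matrix]
    all_goals
      ext i j
      fin_cases i <;> fin_cases j <;> simp [v33Matrix, pow_two, hx]))

/-- The coaction of `𝒦` on `V_{3,3}`: `δ(e₁) = a ⊗ e₁ + (1 + ξ) b ⊗ e₂` and
`δ(e₂) = d ⊗ e₂ + ½ (1 - ξ) c ⊗ e₁`. -/
def v33Coact : (Fin 2 → k) →ₗ[k] KAlg ξ ⊗[k] (Fin 2 → k) :=
  (LinearMap.proj 0).smulRight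
      (gen ξ .a ⊗ₜ Pi.single 0 1 + ((1 + ξ) • gen ξ .b) ⊗ₜ Pi.single 1 1) +
    (LinearMap.proj 1).smulRight
      (gen ξ .d ⊗ₜ Pi.single 1 1 + (((1 - ξ) / 2) • gen ξ .c) ⊗ₜ Pi.single 0 1)

lemma v33Act_a_0 (hξ : IsPrimitiveRoot ξ 4) :
    v33Act ξ hξ (gen ξ .a) (Pi.single 0 1) = -ξ • Pi.single 0 1 := by
  ext i; fin_cases i <;> simp [v33Act, v33Matrix]

lemma v33Act_a_1 (hξ : IsPrimitiveRoot ξ 4) :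
    v33Act ξ hξ (gen ξ .a) (Pi.single 1 1) = -Pi.single 1 1 := by
  ext i; fin_cases i <;> simp [v33Act, v33Matrix]

lemma v33Act_b_0 (hξ : IsPrimitiveRoot ξ 4) :
    v33Act ξ hξ (gen ξ .b) (Pi.single 0 1) = 0 := by
  ext i; fin_cases i <;> simp [v33Act, v33Matrix]

lemma v33Act_b_1 (hξ : IsPrimitiveRoot ξ 4) :
    v33Act ξ hξ (gen ξ .b) (Pi.single 1 1) = -Pi.single 0 1 := by
  ext i; fin_cases i <;> simp [v33Act, v33Matrix]

lemma v33Act_c_0 (hξ : IsPrimitiveRoot ξ 4) :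
    v33Act ξ hξ (gen ξ .c) (Pi.single 0 1) = 0 := by
  ext i; fin_cases i <;> simp [v33Act, v33Matrix]

lemma v33Act_c_1 (hξ : IsPrimitiveRoot ξ 4) :
    v33Act ξ hξ (gen ξ .c) (Pi.single 1 1) = Pi.single 0 1 := by
  ext i; fin_cases i <;> simp [v33Act, v33Matrix]

lemma v33Act_d_0 (hξ : IsPrimitiveRoot ξ 4) :
    v33Act ξ hξ (gen ξ .d) (Pi.single 0 1) = ξ • Pi.single 0 1 := by
  ext i; fin_cases i <;> simp [v33Act, v33Matrix]

lemma v33Act_d_1 (hξ : IsPrimitiveRoot ξ 4) :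
    v33Act ξ hξ (gen ξ .d) (Pi.single 1 1) = -Pi.single 1 1 := by
  ext i; fin_cases i <;> simp [v33Act, v33Matrix]

lemma v33Coact_0 : v33Coact ξ (Pi.single 0 1) =
    gen ξ .a ⊗ₜ Pi.single 0 1 + ((1 + ξ) • gen ξ .b) ⊗ₜ Pi.single 1 1 := by
  simp [v33Coact]

lemma v33Coact_1 : v33Coact ξ (Pi.single 1 1) =
    gen ξ .d ⊗ₜ Pi.single 1 1 + (((1 - ξ) / 2) • gen ξ .c) ⊗ₜ Pi.single 0 1 := by
  simp [v33Coact]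

/-- Products of three generators of `𝒦`, expressed in a basis. -/
lemma gen_triple (hξ : IsPrimitiveRoot ξ 4) :
    gen ξ .d * gen ξ .d = gen ξ .a * gen ξ .a ∧
    gen ξ .a * (gen ξ .a * gen ξ .a) = gen ξ .d ∧
    gen ξ .a * (gen ξ .b * gen ξ .a) = -(ξ • gen ξ .c) ∧
    gen ξ .a * (gen ξ .c * gen ξ .a) = -(ξ • gen ξ .b) ∧
    gen ξ .b * (gen ξ .a * gen ξ .a) = -gen ξ .c ∧
    gen ξ .c * (gen ξ .a * gen ξ .a) = -gen ξ .b ∧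
    gen ξ .d * (gen ξ .a * gen ξ .a) = gen ξ .a ∧
    gen ξ .d * (gen ξ .b * gen ξ .a) = -(ξ • gen ξ .b) ∧
    gen ξ .d * (gen ξ .c * gen ξ .a) = -(ξ • gen ξ .c) ∧
    gen ξ .b * (gen ξ .b * gen ξ .a) = 0 ∧ gen ξ .b * (gen ξ .c * gen ξ .a) = 0 ∧
    gen ξ .c * (gen ξ .b * gen ξ .a) = 0 ∧ gen ξ .c * (gen ξ .c * gen ξ .a) = 0 := by
  have hx := xi_mul_xi hξ
  have hcaa : gen ξ .c * (gen ξ .a * gen ξ .a) = -gen ξ .b := by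
    rw [← gen_aac, mul_assoc (gen ξ .a), gen_ac, mul_smul_comm, ← mul_assoc (gen ξ .a) (gen ξ .c),
      gen_ac, smul_mul_assoc, smul_smul, hx, mul_assoc]
    simp
  have haab : gen ξ .a * (gen ξ .a * gen ξ .b) = gen ξ .c := by
    rw [← gen_aac, ← mul_assoc, ← mul_assoc, ← mul_assoc, ← pow_two, ← pow_succ, ← pow_succ,
      gen_aaaa, one_mul]
  have hbaa : gen ξ .b * (gen ξ .a * gen ξ .a) = -gen ξ .c := by
    rw [← haab, gen_ab, mul_smul_comm, ← mul_assoc (gen ξ .a) (gen ξ .b),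
      gen_ab, smul_mul_assoc, smul_smul, hx, mul_assoc]
    simp
  have hdd : gen ξ .d * gen ξ .d = gen ξ .a * gen ξ .a := by
    rw [← gen_aaa, mul_assoc, gen_aaa, gen_ad, mul_one]
  refine ⟨hdd, by rw [← mul_assoc, gen_aaa], ?_, ?_, hbaa, hcaa, ?_, ?_, ?_, ?_, ?_, ?_, ?_⟩ <;>
    rw [← mul_assoc]
  all_goals simp [gen_ab, gen_ac, gen_da, gen_db, gen_dc, gen_bb, gen_bc, gen_cb, gen_cc,
    mul_assoc, hbaa, hcaa]

lemma ydTwist_mul {V : Type*} [AddCommGroup V] [Module k V]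
    (act : KAlg ξ →ₐ[k] Module.End k V) (X Y : KAlg ξ ⊗[k] (KAlg ξ ⊗[k] KAlg ξ)) :
    ydTwist act (X * Y) = ydTwist act X * ydTwist act Y := by
  have key : (LinearMap.mul k _).compr₂ (ydTwist act) =
      (LinearMap.mul k (Module.End k (KAlg ξ ⊗[k] V))).compl₁₂ (ydTwist act) (ydTwist act) := by
    ext h₁ h₂ h₃ g₁ g₂ g₃ x v
    simp only [TensorProduct.AlgebraTensorModule.curry_apply, TensorProduct.curry_apply,
      LinearMap.compr₂_apply, LinearMap.compl₁₂_apply, LinearMap.mul_apply', LinearMap.coe_restrictScalars,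
      LinearMap.restrictScalars_self,
      Algebra.TensorProduct.tmul_mul_tmul, ydTwist_tmul, Module.End.mul_apply, map_mul,
      show ∀ z w : KAlg ξ, HopfAlgebra.antipode k (z * w) =
        HopfAlgebra.antipode k w * HopfAlgebra.antipode k z from antipodeLin_mul ξ, mul_assoc]
  exact LinearMap.congr_fun₂ key X Y

variable {ξ} in
lemma one_add_xi_mul (hξ : IsPrimitiveRoot ξ 4) : (1 + ξ) * ((1 - ξ) / 2) = 1 := by
  have hx := xi_mul_xi hξ
  have h2 : (2 : k) ≠ 0 := by
    intro h
    refine absurd (hξ.dvd_of_pow_eq_one 2 ?_) (by decide)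
    linear_combination hx - h
  field_simp
  linear_combination -hx

lemma v33_coassoc (hξ' : IsPrimitiveRoot ξ 4) (v : Fin 2 → k) :
    TensorProduct.assoc k (KAlg ξ) (KAlg ξ) (Fin 2 → k)
      ((Coalgebra.comul (R := k) (A := KAlg ξ)).rTensor (Fin 2 → k) (v33Coact ξ v)) =
        (v33Coact ξ).lTensor (KAlg ξ) (v33Coact ξ v) := by
  suffices h : (TensorProduct.assoc k _ _ (Fin 2 → k)).toLinearMap ∘ₗ
      (Coalgebra.comul (R := k) (A := KAlg ξ)).rTensor (Fin 2 → k) ∘ₗ v33Coact ξ =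
        (v33Coact ξ).lTensor (KAlg ξ) ∘ₗ v33Coact ξ from LinearMap.congr_fun h v
  have h1 := one_add_xi_mul hξ'
  have h2 := (mul_comm _ _).trans h1
  refine (Pi.basisFun k (Fin 2)).ext fun i => ?_
  fin_cases i
  · simp [v33Coact_0, v33Coact_1, comul_gen, comulGen, TensorProduct.add_tmul,
      TensorProduct.tmul_add, ← TensorProduct.smul_tmul', smul_smul, h1, h2, smul_add]
    abel
  · simp [v33Coact_0, v33Coact_1, comul_gen, comulGen, TensorProduct.add_tmul,
      TensorProduct.tmul_add, ← TensorProduct.smul_tmul', smul_smul, h1, h2, smul_add]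
    abel

lemma v33_coact_act (hξ' : IsPrimitiveRoot ξ 4) (h : KAlg ξ) :
    v33Coact ξ ∘ₗ v33Act ξ hξ' h = ydTwist (v33Act ξ hξ')
      ((Coalgebra.comul (R := k) (A := KAlg ξ)).lTensor (KAlg ξ) (Coalgebra.comul (R := k) h)) ∘ₗ
        v33Coact ξ := by
  have hx := xi_mul_xi hξ'
  induction h using induction_on with
  | hs r =>
    rw [Algebra.algebraMap_eq_smul_one]
    ext i
    simp [Algebra.TensorProduct.one_def, v33Coact]
  | ha x y h₁ h₂ => simp only [map_add, LinearMap.comp_add, LinearMap.add_comp, h₁, h₂]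
  | hm x y h₁ h₂ =>
    have hmul : ∀ X Y : KAlg ξ ⊗[k] KAlg ξ,
        (Coalgebra.comul (R := k) (A := KAlg ξ)).lTensor (KAlg ξ) (X * Y) =
        (Coalgebra.comul (R := k) (A := KAlg ξ)).lTensor (KAlg ξ) X *
        (Coalgebra.comul (R := k) (A := KAlg ξ)).lTensor (KAlg ξ) Y :=
      fun X Y => map_mul (Algebra.TensorProduct.map (AlgHom.id k (KAlg ξ))
        (Bialgebra.comulAlgHom k (KAlg ξ))) X Y
    rw [Bialgebra.comul_mul, hmul, ydTwist_mul, map_mul]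
    simp only [Module.End.mul_eq_comp, LinearMap.comp_assoc]
    rw [← h₂, ← LinearMap.comp_assoc, h₁, LinearMap.comp_assoc]
  | hg i =>
    refine (Pi.basisFun k (Fin 2)).ext fun j => ?_
    obtain ⟨hdd, haaa, haba, haca, hbaa, hcaa, hdaa, hdba, hdca, hbba, hbca, hcba, hcca⟩ :=
      gen_triple ξ hξ'
    have hh : (1 - ξ) / 2 + (1 - ξ) / 2 = 1 - ξ := by
      have h := one_add_xi_mul hξ'
      linear_combination (1 - ξ) * h + (1 - ξ) / 2 * hx
    have hA : ∀ z, HopfAlgebra.antipode k (gen ξ z) = antipodeGen ξ z := antipode_gen ξ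
    cases i <;> fin_cases j <;>
    simp [v33Coact_0, v33Coact_1, comul_gen, comulGen, TensorProduct.add_tmul, TensorProduct.tmul_add,
      hA, antipodeGen,
      v33Act_a_0, v33Act_a_1, v33Act_b_0, v33Act_b_1,v33Act_c_0, v33Act_c_1,v33Act_d_0, v33Act_d_1,
      hdd, haaa, haba, haca, hbaa, hcaa, hdaa, hdba, hdca, hbba, hbca, hcba, hcca,
      gen_bb, gen_cc, gen_ab, gen_ac, gen_cb, gen_bc, gen_cd, gen_bd, gen_db, gen_dc, gen_ad,
      gen_da, ← TensorProduct.smul_tmul', TensorProduct.neg_tmul, TensorProduct.tmul_neg, smul_smul, hx]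
    · module
    · match_scalars <;> first | ring1 | linear_combination -hh
    · match_scalars; linear_combination -hx
    · module
    · match_scalars; linear_combination -hx
    · module
    · module
    · match_scalars <;> first | ring1 | linear_combination -hh

/-- The Yetter–Drinfeld module `V_{3,3}` over `𝒦`, with basis
`e₁ = Pi.single 0 1`, `e₂ = Pi.single 1 1`. -/
def V33 : YetterDrinfeldModule k (KAlg ξ) (Fin 2 → k) where
  act := v33Act ξ hξ.out
  coact := v33Coact ξ
  counit_coact := by
    suffices h : (TensorProduct.lid k (Fin 2 → k)).toLinearMap ∘ₗ
        (Coalgebra.counit (R := k) (A := KAlg ξ)).rTensor (Fin 2 → k) ∘ₗ v33Coact ξ =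
          LinearMap.id from fun v => LinearMap.congr_fun h v
    refine (Pi.basisFun k (Fin 2)).ext fun i => ?_
    fin_cases i <;>
      simp [v33Coact_0, v33Coact_1, counit_gen, counitGen]
  coassoc := v33_coassoc ξ hξ.out
  coact_act h v := LinearMap.congr_fun (v33_coact_act ξ hξ.out h) v

end KHopf

end

/-! Write `J` for the two-sided ideal of `T(V)` generated by the three relations and `I` for the
Nichols ideal. Modulo `J` every element is a combination of the eight monomials `xⁱ yʲ` with `i <
2`, `j < 4` (`span_monomials`). So it is enough that `J ⊆ I` and that these monomials are linearly
independent modulo `I`; the presentation and the dimension follow at once.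

For `J ⊆ I`, maximality of `I` reduces the claim to `J` being a coideal
(`relationIdeal_mem_coidealIdeals`). The elements `a, b, c, d` form a 2 × 2 matrix coalgebra, so
letting them act on an algebra `R` by the module algebra law amounts to an algebra map `ρ : R →
M₂(R)`. The matrices attached to `x` and `y` satisfy the relations when `x` and `y` do, hence the
action descends to `R = T(V)/J`. Left multiplication by `x ⊗ 1 + 1 ⊗ x` and by `y ⊗ 1 + 1 ⊗ y` then
become explicit operators on `R ⊗ R`, and a computation shows that they too satisfy the three
relations. The image of `Δ(t)` in `R ⊗ R` is the operator of `t` applied to `1 ⊗ 1`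
(`map_braidedComul`), so it vanishes for `t ∈ J`; the kernel of `T(V) ⊗ T(V) → R ⊗ R` is `J ⊗ T(V) +
T(V) ⊗ J`. Because operators are composed, associativity of the braided product is never needed.

For independence, contracting the first factor of `Δ` with the two degree-one coordinates gives skew
derivations `d₀, d₁` of `T(V)`. Since `I` is a coideal generated in degrees at least two, they and
the augmentation pass to the quotient (`linearIndependent_nichols`). Eight words in `d₀, d₁`, each
followed by the augmentation, then separate the eight monomials (`linearIndependent_monomials`). -/

noncomputable section

namespace KHopf

/-! ### Spanning by monomials in an algebra satisfying the relations -/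

section Presentation

variable {k R : Type*} [Field k] [Ring R] [Algebra k R] {x y : R}

/-- A subspace containing `1` and stable under left multiplication by generators is everything. -/
lemma eq_top_of_mul_mem (hgen : Algebra.adjoin k {x, y} = ⊤) (p : Submodule k R) (h1 : 1 ∈ p)
    (hx : ∀ r ∈ p, x * r ∈ p) (hy : ∀ r ∈ p, y * r ∈ p) : p = ⊤ := by
  have key : ∀ t ∈ Algebra.adjoin k {x, y}, ∀ r ∈ p, t * r ∈ p := by
    intro t ht
    induction ht using Algebra.adjoin_induction with
    | mem t ht =>
      rcases ht with rfl | rfl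
      exacts [hx, hy]
    | algebraMap c => intro r hr; rw [← Algebra.smul_def]; exact p.smul_mem c hr
    | add s t _ _ hs ht => intro r hr; rw [add_mul]; exact p.add_mem (hs r hr) (ht r hr)
    | mul s t _ _ hs ht => intro r hr; rw [mul_assoc]; exact hs _ (ht r hr)
  refine eq_top_iff.2 fun t _ => ?_
  simpa using key t (hgen ▸ Algebra.mem_top) 1 h1

/-- The monomials `xⁱ yʲ` with `i < 2` and `j < 4`. -/
def monomials (x y : R) (p : Fin 2 × Fin 4) : R := x ^ (p.1 : ℕ) * y ^ (p.2 : ℕ)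

/-- The span is stable under left multiplication: `x` turns `x yʲ` into `2 yʲ⁺²`, and `y` passes
through `x` at the cost of a sign. -/
lemma span_monomials (hgen : Algebra.adjoin k {x, y} = ⊤) (hxx : x * x = 2 * (y * y))
    (hyx : y * x = -(x * y)) (hy4 : y ^ 4 = 0) :
    Submodule.span k (Set.range (monomials x y)) = ⊤ := by
  set p := Submodule.span k (Set.range (monomials x y)) with hp
  -- All exponents `j` are allowed: multiplication raises `j` to as much as 5, and powers from `y ^
  -- 4` on vanish.
  have hmem : ∀ (i j : ℕ), i < 2 → x ^ i * y ^ j ∈ p := by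
    intro i j hi
    by_cases hj : j < 4
    · exact Submodule.subset_span ⟨(⟨i, hi⟩, ⟨j, hj⟩), rfl⟩
    · obtain ⟨l, rfl⟩ := Nat.exists_eq_add_of_le (not_lt.1 hj)
      simp [pow_add, hy4]
  have h0 : ∀ j : ℕ, y ^ j ∈ p := fun j => by simpa using hmem 0 j (by omega)
  have h1 : ∀ j : ℕ, x * y ^ j ∈ p := fun j => by simpa using hmem 1 j (by omega)
  refine eq_top_of_mul_mem hgen p (by simpa using h0 0) ?_ ?_
  · intro r hr
    suffices h : p ≤ p.comap (LinearMap.mulLeft k x) from h hr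
    refine Submodule.span_le.2 ?_
    rintro _ ⟨⟨i, j⟩, rfl⟩
    fin_cases i
    · simpa [monomials] using h1 j
    · have : x * (x * y ^ (j : ℕ)) = y ^ (j + 2 : ℕ) + y ^ (j + 2 : ℕ) := by
        rw [← mul_assoc, hxx, ← pow_two, mul_assoc, ← pow_add, add_comm, two_mul]
      simpa [monomials, this] using p.add_mem (h0 (j + 2)) (h0 (j + 2))
  · intro r hr
    suffices h : p ≤ p.comap (LinearMap.mulLeft k y) from h hr
    refine Submodule.span_le.2 ?_
    rintro _ ⟨⟨i, j⟩, rfl⟩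
    fin_cases i
    · simpa [monomials, ← pow_succ'] using h0 (j + 1)
    · have : y * (x * y ^ (j : ℕ)) = -(x * y ^ (j + 1 : ℕ)) := by
        rw [← mul_assoc, hyx, neg_mul, mul_assoc, ← pow_succ']
      simpa [monomials, this] using h1 (j + 1)

end Presentation

/-! ### The action of the matrix coalgebra as a map to 2 × 2 matrices -/

section Action

variable {k R : Type*} [Field k] {ξ : k} [Ring R] [Algebra k R] {x y : R}

/-- An entry of an algebra map to two-by-two matrices, as a linear map. -/
def entry (ρ : R →ₐ[k] Matrix (Fin 2) (Fin 2) R) (i j : Fin 2) : R →ₗ[k] R :=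
  Matrix.entryLinearMap k R i j ∘ₗ ρ.toLinearMap

lemma entry_apply (ρ : R →ₐ[k] Matrix (Fin 2) (Fin 2) R) (i j : Fin 2) (r : R) :
    entry ρ i j r = ρ r i j := rfl

/-- This is the module algebra law for the comatrix coproduct, with `entry ρ i j` in the role of the
generator in position `(i, j)` of `a, b; c, d`. -/
lemma entry_mul (ρ : R →ₐ[k] Matrix (Fin 2) (Fin 2) R) (i j : Fin 2) (r s : R) :
    entry ρ i j (r * s) = entry ρ i 0 r * entry ρ 0 j s + entry ρ i 1 r * entry ρ 1 j s := by
  simp [entry_apply, Matrix.mul_apply]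

variable (ξ x y) in
/-- The matrices over an algebra containing `x = e₁` and `y = e₂` whose entries are the results of
the action of `a, b, c, d` on `x` and `y`. -/
def actMatrix : Fin 2 → Matrix (Fin 2) (Fin 2) R :=
  ![!![-(ξ • x), 0; 0, ξ • x], !![-y, -x; x, -y]]

variable {ρ : R →ₐ[k] Matrix (Fin 2) (Fin 2) R}

lemma entry_x_mul (hx : ρ x = actMatrix ξ x y 0) (r : R) :
    (∀ j, entry ρ 0 j (x * r) = -(ξ • (x * entry ρ 0 j r))) ∧
    (∀ j, entry ρ 1 j (x * r) = ξ • (x * entry ρ 1 j r)) := by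
  refine ⟨fun j => ?_, fun j => ?_⟩ <;> rw [entry_mul] <;>
    simp [entry_apply, hx, actMatrix]

lemma entry_y_mul (hy : ρ y = actMatrix ξ x y 1) (r : R) :
    (∀ j, entry ρ 0 j (y * r) = -(y * entry ρ 0 j r) - x * entry ρ 1 j r) ∧
    (∀ j, entry ρ 1 j (y * r) = x * entry ρ 0 j r - y * entry ρ 1 j r) := by
  refine ⟨fun j => ?_, fun j => ?_⟩ <;> rw [entry_mul] <;>
    simp [entry_apply, hy, actMatrix, sub_eq_add_neg]

lemma entry_one (i j : Fin 2) : entry ρ i j 1 = if i = j then 1 else 0 := by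
  simp [entry_apply, Matrix.one_apply]

/-- The entries of `ρ` satisfy the quadratic relations of `𝒦`. -/
lemma entry_relations (hξ : ξ * ξ = -1) (hgen : Algebra.adjoin k {x, y} = ⊤)
    (hx : ρ x = actMatrix ξ x y 0) (hy : ρ y = actMatrix ξ x y 1) (r : R) :
    entry ρ 0 0 (entry ρ 0 1 r) = ξ • entry ρ 0 1 (entry ρ 0 0 r) ∧
    entry ρ 0 0 (entry ρ 1 0 r) = ξ • entry ρ 1 0 (entry ρ 0 0 r) ∧
    entry ρ 1 0 (entry ρ 0 1 r) = 0 ∧ entry ρ 0 1 (entry ρ 1 0 r) = 0 ∧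
    entry ρ 0 1 (entry ρ 0 1 r) = 0 ∧ entry ρ 1 0 (entry ρ 1 0 r) = 0 ∧
    entry ρ 1 0 (entry ρ 1 1 r) = -entry ρ 0 1 (entry ρ 0 0 r) ∧
    entry ρ 0 1 (entry ρ 1 1 r) = -entry ρ 1 0 (entry ρ 0 0 r) ∧
    entry ρ 1 1 (entry ρ 0 1 r) = ξ • entry ρ 1 0 (entry ρ 0 0 r) ∧
    entry ρ 1 1 (entry ρ 1 0 r) = ξ • entry ρ 0 1 (entry ρ 0 0 r) ∧
    entry ρ 0 0 (entry ρ 1 1 r) = r ∧ entry ρ 1 1 (entry ρ 0 0 r) = r ∧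
    entry ρ 1 1 (entry ρ 1 1 r) = entry ρ 0 0 (entry ρ 0 0 r) := by
  -- The relations are proved simultaneously: multiplying by `y` mixes the rows of `ρ`, so each one
  -- for `y * r` calls on several of them for `r`. Every right-hand side is in a normal form built
  -- from `a²`, `ba`, `ca` and `1`.
  let p : Submodule k R :=
    { carrier := {r | entry ρ 0 0 (entry ρ 0 1 r) = ξ • entry ρ 0 1 (entry ρ 0 0 r) ∧
        entry ρ 0 0 (entry ρ 1 0 r) = ξ • entry ρ 1 0 (entry ρ 0 0 r) ∧
        entry ρ 1 0 (entry ρ 0 1 r) = 0 ∧ entry ρ 0 1 (entry ρ 1 0 r) = 0 ∧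
        entry ρ 0 1 (entry ρ 0 1 r) = 0 ∧ entry ρ 1 0 (entry ρ 1 0 r) = 0 ∧
        entry ρ 1 0 (entry ρ 1 1 r) = -entry ρ 0 1 (entry ρ 0 0 r) ∧
        entry ρ 0 1 (entry ρ 1 1 r) = -entry ρ 1 0 (entry ρ 0 0 r) ∧
        entry ρ 1 1 (entry ρ 0 1 r) = ξ • entry ρ 1 0 (entry ρ 0 0 r) ∧
        entry ρ 1 1 (entry ρ 1 0 r) = ξ • entry ρ 0 1 (entry ρ 0 0 r) ∧
        entry ρ 0 0 (entry ρ 1 1 r) = r ∧ entry ρ 1 1 (entry ρ 0 0 r) = r ∧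
        entry ρ 1 1 (entry ρ 1 1 r) = entry ρ 0 0 (entry ρ 0 0 r)}
      zero_mem' := by simp
      add_mem' := by
        rintro r s ⟨h1, h2, h3, h4, h5, h6, h7, h8, h9, h10, h11, h12, h13⟩
          ⟨g1, g2, g3, g4, g5, g6, g7, g8, g9, g10, g11, g12, g13⟩
        simp [h1, h2, h3, h4, h5, h6, h7, h8, h9, h10, h11, h12, h13,
          g1, g2, g3, g4, g5, g6, g7, g8, g9, g10, g11, g12, g13, add_comm]
      smul_mem' := by
        rintro c r ⟨h1, h2, h3, h4, h5, h6, h7, h8, h9, h10, h11, h12, h13⟩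
        simp [h1, h2, h3, h4, h5, h6, h7, h8, h9, h10, h11, h12, h13, smul_comm c ξ] }
  have hp : p = ⊤ := by
    refine eq_top_of_mul_mem hgen p ?_ ?_ ?_
    · simp [p, entry_one]
    · rintro r ⟨h1, h2, h3, h4, h5, h6, h7, h8, h9, h10, h11, h12, h13⟩
      have hX := fun s => (entry_x_mul (ξ := ξ) hx s).1
      have hX' := fun s => (entry_x_mul (ξ := ξ) hx s).2
      refine ⟨?_, ?_, ?_, ?_, ?_, ?_, ?_, ?_, ?_, ?_, ?_, ?_, ?_⟩ <;>
        simp only [hX, hX', map_neg, map_smul, mul_neg, mul_smul_comm, smul_neg, neg_neg, smul_smul,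
          hξ, h1, h2, h3, h4, h5, h6, h7, h8, h9, h10, h11, h12, h13, mul_zero, smul_zero, neg_zero,
          neg_smul, one_smul, mul_neg, neg_mul, one_mul]
    · rintro r ⟨h1, h2, h3, h4, h5, h6, h7, h8, h9, h10, h11, h12, h13⟩
      have hX := fun s => (entry_x_mul (ξ := ξ) hx s).1
      have hX' := fun s => (entry_x_mul (ξ := ξ) hx s).2
      have hY := fun s => (entry_y_mul (ξ := ξ) hy s).1
      have hY' := fun s => (entry_y_mul (ξ := ξ) hy s).2
      refine ⟨?_, ?_, ?_, ?_, ?_, ?_, ?_, ?_, ?_, ?_, ?_, ?_, ?_⟩ <;>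
        simp only [hX, hX', hY, hY', map_neg, map_smul, map_sub, mul_neg, mul_smul_comm, smul_neg,
          neg_neg, smul_smul, mul_sub, smul_sub,
          hξ, h1, h2, h3, h4, h5, h6, h7, h8, h9, h10, h11, h12, h13, mul_zero, smul_zero, neg_zero,
          neg_smul, one_smul, mul_neg, neg_mul, one_mul] <;> abel
  exact (hp ▸ Submodule.mem_top : r ∈ p)

end Action

/-! ### The relations for braided left multiplication on the tensor square -/

section Braided

variable {k R : Type*} [Field k] [Ring R] [Algebra k R]

variable (ξ : k) (ρ : R →ₐ[k] Matrix (Fin 2) (Fin 2) R) (x y : R)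

/-- Multiplication by `x ⊗ 1 + 1 ⊗ x` in the braided tensor square, where `x = e₁`. -/
def braidedLeftX : Module.End k (R ⊗[k] R) :=
  TensorProduct.map (LinearMap.mulLeft k x) LinearMap.id +
    (TensorProduct.map (entry ρ 0 0) (LinearMap.mulLeft k x) +
      (1 + ξ) • TensorProduct.map (entry ρ 0 1) (LinearMap.mulLeft k y))

/-- Multiplication by `y ⊗ 1 + 1 ⊗ y` in the braided tensor square, where `y = e₂`. -/
def braidedLeftY : Module.End k (R ⊗[k] R) :=
  TensorProduct.map (LinearMap.mulLeft k y) LinearMap.id +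
    (TensorProduct.map (entry ρ 1 1) (LinearMap.mulLeft k y) +
      ((1 - ξ) / 2) • TensorProduct.map (entry ρ 1 0) (LinearMap.mulLeft k x))

lemma braidedLeftX_tmul (r s : R) : braidedLeftX ξ ρ x y (r ⊗ₜ s) =
    (x * r) ⊗ₜ s + (entry ρ 0 0 r ⊗ₜ (x * s) + (1 + ξ) • entry ρ 0 1 r ⊗ₜ (y * s)) := by
  simp [braidedLeftX]

lemma braidedLeftY_tmul (r s : R) : braidedLeftY ξ ρ x y (r ⊗ₜ s) =
    (y * r) ⊗ₜ s + (entry ρ 1 1 r ⊗ₜ (y * s) + ((1 - ξ) / 2) • entry ρ 1 0 r ⊗ₜ (x * s)) := by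
  simp [braidedLeftY]

variable {ξ ρ x y}

/-- This is the relation `xy + yx = 0` for the primitive lifts of `x` and `y` to the braided square.
It is checked on every `r ⊗ s`, not only on `1 ⊗ 1`, so that a whole two-sided ideal of operators is
killed. -/
lemma braidedLeft_anticomm (h2 : (2 : k) ≠ 0) (hξ : ξ * ξ = -1)
    (hgen : Algebra.adjoin k {x, y} = ⊤)
    (hx : ρ x = actMatrix ξ x y 0) (hy : ρ y = actMatrix ξ x y 1)
    (hxx : x * x = (2 : k) • (y * y)) (hyx : y * x = -(x * y)) :
    braidedLeftX ξ ρ x y * braidedLeftY ξ ρ x y + braidedLeftY ξ ρ x y * braidedLeftX ξ ρ x y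
      = 0 := by
  ext r s
  have hX := fun s => (entry_x_mul (ξ := ξ) hx s).1
  have hX' := fun s => (entry_x_mul (ξ := ξ) hx s).2
  have hY := fun s => (entry_y_mul (ξ := ξ) hy s).1
  have hY' := fun s => (entry_y_mul (ξ := ξ) hy s).2
  obtain ⟨h1, h2, h3, h4, h5, h6, h7, h8, h9, h10, h11, h12, h13⟩ :=
    entry_relations hξ hgen hx hy r
  have hxx' : ∀ s, x * (x * s) = (2 : k) • (y * (y * s)) := fun s => by
    rw [← mul_assoc, hxx, smul_mul_assoc, mul_assoc]
  have hyx' : ∀ s, y * (x * s) = -(x * (y * s)) := fun s => by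
    rw [← mul_assoc, hyx, neg_mul, mul_assoc]
  simp only [TensorProduct.AlgebraTensorModule.curry_apply, TensorProduct.curry_apply,
    LinearMap.coe_restrictScalars, LinearMap.restrictScalars_self, LinearMap.add_apply,
    Module.End.mul_apply, braidedLeftX_tmul, braidedLeftY_tmul, map_add, map_smul, hX, hX', hY, hY',
    h1, h2, h3, h4, h5, h6, h7, h8, h9, h10, h11, h12, h13, hxx', hyx', ← TensorProduct.smul_tmul',
    TensorProduct.tmul_smul, TensorProduct.neg_tmul, TensorProduct.tmul_neg,
    TensorProduct.sub_tmul, TensorProduct.zero_tmul, LinearMap.zero_apply]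
  -- Both sides are now combinations of the same normal-form tensors, so only scalar identities
  -- modulo `ξ * ξ = -1` are left.
  match_scalars <;> field_simp <;> first | ring1 | linear_combination hξ | linear_combination -hξ

lemma braidedLeft_sq (h2 : (2 : k) ≠ 0) (hξ : ξ * ξ = -1)
    (hgen : Algebra.adjoin k {x, y} = ⊤)
    (hx : ρ x = actMatrix ξ x y 0) (hy : ρ y = actMatrix ξ x y 1)
    (hxx : x * x = (2 : k) • (y * y)) (hyx : y * x = -(x * y)) :
    braidedLeftX ξ ρ x y * braidedLeftX ξ ρ x y =
      (2 : k) • (braidedLeftY ξ ρ x y * braidedLeftY ξ ρ x y) := by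
  ext r s
  have hX := fun s => (entry_x_mul (ξ := ξ) hx s).1
  have hX' := fun s => (entry_x_mul (ξ := ξ) hx s).2
  have hY := fun s => (entry_y_mul (ξ := ξ) hy s).1
  have hY' := fun s => (entry_y_mul (ξ := ξ) hy s).2
  obtain ⟨h1, h2, h3, h4, h5, h6, h7, h8, h9, h10, h11, h12, h13⟩ :=
    entry_relations hξ hgen hx hy r
  have hxx' : ∀ s, x * (x * s) = (2 : k) • (y * (y * s)) := fun s => by
    rw [← mul_assoc, hxx, smul_mul_assoc, mul_assoc]
  have hyx' : ∀ s, y * (x * s) = -(x * (y * s)) := fun s => by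
    rw [← mul_assoc, hyx, neg_mul, mul_assoc]
  simp only [TensorProduct.AlgebraTensorModule.curry_apply, TensorProduct.curry_apply,
    LinearMap.coe_restrictScalars, LinearMap.restrictScalars_self, LinearMap.smul_apply,
    Module.End.mul_apply, braidedLeftX_tmul, braidedLeftY_tmul, map_add, map_smul, hX, hX', hY, hY',
    h1, h2, h3, h4, h5, h6, h7, h8, h9, h10, h11, h12, h13, hxx', hyx', ← TensorProduct.smul_tmul',
    TensorProduct.tmul_smul, TensorProduct.neg_tmul, TensorProduct.tmul_neg,
    TensorProduct.sub_tmul, TensorProduct.zero_tmul]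
  match_scalars <;> field_simp <;> first | ring1 | linear_combination hξ | linear_combination -hξ

/-- Squaring first keeps the fourth power manageable. Of the nine terms, those in `y * entry ρ 1 1
r` and `y * entry ρ 1 0 r` cancel, one vanishes as `c² = 0`, and the two in `ba` merge with
coefficient `-(1 + ξ) * ((1 - ξ) / 2) = -1`. -/
lemma braidedLeftY_sq_tmul (h2 : (2 : k) ≠ 0) (hξ : ξ * ξ = -1)
    (hgen : Algebra.adjoin k {x, y} = ⊤)
    (hx : ρ x = actMatrix ξ x y 0) (hy : ρ y = actMatrix ξ x y 1)
    (hyx : y * x = -(x * y)) (r s : R) :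
    (braidedLeftY ξ ρ x y * braidedLeftY ξ ρ x y) (r ⊗ₜ s) =
      (y * (y * r)) ⊗ₜ s + (x * entry ρ 0 1 r) ⊗ₜ (y * s) +
        ((1 - ξ) / 2) • (x * entry ρ 0 0 r) ⊗ₜ (x * s) +
        entry ρ 0 0 (entry ρ 0 0 r) ⊗ₜ (y * (y * s)) -
        entry ρ 0 1 (entry ρ 0 0 r) ⊗ₜ (x * (y * s)) := by
  have hX := fun s => (entry_x_mul (ξ := ξ) hx s).1
  have hX' := fun s => (entry_x_mul (ξ := ξ) hx s).2
  have hY := fun s => (entry_y_mul (ξ := ξ) hy s).1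
  have hY' := fun s => (entry_y_mul (ξ := ξ) hy s).2
  obtain ⟨h1, h2, h3, h4, h5, h6, h7, h8, h9, h10, h11, h12, h13⟩ :=
    entry_relations hξ hgen hx hy r
  have hyx' : ∀ s, y * (x * s) = -(x * (y * s)) := fun s => by
    rw [← mul_assoc, hyx, neg_mul, mul_assoc]
  simp only [Module.End.mul_apply, braidedLeftX_tmul, braidedLeftY_tmul, map_add, map_smul, hX, hX',
    hY, hY',
    h1, h2, h3, h4, h5, h6, h7, h8, h9, h10, h11, h12, h13, hyx', ← TensorProduct.smul_tmul',
    TensorProduct.tmul_smul, TensorProduct.neg_tmul, TensorProduct.tmul_neg,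
    TensorProduct.sub_tmul, TensorProduct.zero_tmul, TensorProduct.tmul_zero]
  match_scalars <;> field_simp <;> first | ring1 | linear_combination hξ

lemma braidedLeftY_pow_four (h2 : (2 : k) ≠ 0) (hξ : ξ * ξ = -1)
    (hgen : Algebra.adjoin k {x, y} = ⊤)
    (hx : ρ x = actMatrix ξ x y 0) (hy : ρ y = actMatrix ξ x y 1)
    (hxx : x * x = (2 : k) • (y * y)) (hyx : y * x = -(x * y)) (hy4 : y ^ 4 = 0) :
    braidedLeftY ξ ρ x y ^ 4 = 0 := by
  rw [show 4 = 2 * 2 from rfl, pow_mul, pow_two, pow_two]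
  ext r s
  have hX := fun s => (entry_x_mul (ξ := ξ) hx s).1
  have hX' := fun s => (entry_x_mul (ξ := ξ) hx s).2
  have hY := fun s => (entry_y_mul (ξ := ξ) hy s).1
  have hY' := fun s => (entry_y_mul (ξ := ξ) hy s).2
  have h := entry_relations hξ hgen hx hy
  have h1 := fun r => (h r).1
  have h2' := fun r => (h r).2.1
  have h4 := fun r => (h r).2.2.2.1
  have h3 := fun r => (h r).2.2.1
  have h6 := fun r => (h r).2.2.2.2.2.1
  have h5 := fun r => (h r).2.2.2.2.1
  have h7 := fun r => (h r).2.2.2.2.2.2.1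
  have h8 := fun r => (h r).2.2.2.2.2.2.2.1
  have h10 := fun r => (h r).2.2.2.2.2.2.2.2.2.1
  have h11 := fun r => (h r).2.2.2.2.2.2.2.2.2.2.1
  have h12 := fun r => (h r).2.2.2.2.2.2.2.2.2.2.2.1
  have h13 := fun r => (h r).2.2.2.2.2.2.2.2.2.2.2.2
  -- The cubic and quartic rules `ba² = -c`, `ca² = -b`, `a⁴ = 1` follow from the quadratic ones by
  -- trading `a²` for `d²`.
  have hBAA : ∀ r, entry ρ 0 1 (entry ρ 0 0 (entry ρ 0 0 r)) = -entry ρ 1 0 r := fun r => by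
    rw [← h13, h8, h11]
  have hCAA : ∀ r, entry ρ 1 0 (entry ρ 0 0 (entry ρ 0 0 r)) = -entry ρ 0 1 r := fun r => by
    rw [← h13, h7, h11]
  have hAAAA : ∀ r, entry ρ 0 0 (entry ρ 0 0 (entry ρ 0 0 (entry ρ 0 0 r))) = r := fun r => by
    rw [← h13, h12, h12]
  -- Squaring the five-term formula produces higher powers of `ξ`, to be reduced after `ring_nf`.
  have hξ2 : ξ ^ 2 = -1 := by rw [pow_two, hξ]
  have hξ3 : ξ ^ 3 = -ξ := by rw [pow_succ, hξ2, neg_one_mul]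
  have hξ4 : ξ ^ 4 = 1 := by rw [pow_succ, hξ3, neg_mul, hξ, neg_neg]
  have hxx' : ∀ s, x * (x * s) = (2 : k) • (y * (y * s)) := fun s => by
    rw [← mul_assoc, hxx, smul_mul_assoc, mul_assoc]
  have hyx' : ∀ s, y * (x * s) = -(x * (y * s)) := fun s => by
    rw [← mul_assoc, hyx, neg_mul, mul_assoc]
  have hyyyy : ∀ s, y * (y * (y * (y * s))) = 0 := fun s => by
    rw [← mul_assoc, ← mul_assoc, ← mul_assoc, ← pow_three', ← pow_succ, hy4, zero_mul]
  simp only [TensorProduct.AlgebraTensorModule.curry_apply, TensorProduct.curry_apply,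
    LinearMap.coe_restrictScalars, LinearMap.restrictScalars_self,
    Module.End.mul_apply (braidedLeftY ξ ρ x y * _),
    braidedLeftY_sq_tmul h2 hξ hgen hx hy hyx, map_add, map_sub, map_smul, map_neg,
    hX, hX', hY, hY', mul_add, mul_sub, mul_neg, mul_smul_comm, smul_neg, smul_sub, smul_add,
    h1, h2', h3, h4, h5, h6, h10, h12, mul_zero, smul_zero, neg_zero,
    hBAA, hCAA, hAAAA, hxx', hyx', hyyyy, ← TensorProduct.smul_tmul',
    TensorProduct.tmul_smul, TensorProduct.neg_tmul, TensorProduct.tmul_neg,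
    TensorProduct.sub_tmul, TensorProduct.add_tmul, TensorProduct.zero_tmul,
    TensorProduct.tmul_zero, LinearMap.zero_apply]
  match_scalars <;> field_simp <;> (try ring_nf) <;>
    (try simp only [hξ2, hξ3, hξ4]) <;> (try ring1)

end Braided

/-! ### Linear independence from skew derivations -/

section SkewDerivations

variable {k B : Type*} [Field k] {ξ : k} [Ring B] [Algebra k B] {x y : B}

/-- The monomials are linearly independent in an algebra carrying suitable skew derivations. -/
lemma linearIndependent_monomials (h2 : (2 : k) ≠ 0) (hξ : ξ * ξ = -1)
    (hxx : x * x = 2 * (y * y)) (hyx : y * x = -(x * y))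
    (ε : B →ₗ[k] k) (d₀ d₁ : B →ₗ[k] B) (hε1 : ε 1 = 1) (hεx : ∀ u, ε (x * u) = 0)
    (hεy : ∀ u, ε (y * u) = 0) (h01 : d₀ 1 = 0) (h11 : d₁ 1 = 0)
    (h0x : ∀ u, d₀ (x * u) = u - ξ • (x * d₀ u) - (1 + ξ) • (y * d₁ u))
    (h1x : ∀ u, d₁ (x * u) = -(x * d₁ u))
    (h0y : ∀ u, d₀ (y * u) = ξ • (y * d₀ u) + ((1 - ξ) / 2) • (x * d₁ u))
    (h1y : ∀ u, d₁ (y * u) = u - y * d₁ u) :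
    LinearIndependent k (monomials x y) := by
  have hxx' : ∀ u, x * (x * u) = (2 : k) • (y * (y * u)) := fun u => by
    rw [← mul_assoc, hxx, two_mul, two_smul, add_mul, mul_assoc]
  have hyx' : ∀ u, y * (x * u) = -(x * (y * u)) := fun u => by
    rw [← mul_assoc, hyx, neg_mul, mul_assoc]
  have hne : (1 - ξ) / 2 ≠ 0 := by
    intro h
    have h1 : 1 - ξ = 0 := by simpa [h2] using h
    apply h2
    linear_combination (1 + ξ) * h1 + hξ
  have hξ0 : ξ ≠ 0 := by rintro rfl; simp at hξ
  have hex : ε x = 0 := by simpa using hεx 1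
  have hey : ε y = 0 := by simpa using hεy 1
  have e0x : d₀ x = 1 := by simpa [h01, h11] using h0x 1
  have e1x : d₁ x = 0 := by simpa [h01, h11] using h1x 1
  have e0y : d₀ y = 0 := by simpa [h01, h11] using h0y 1
  have e1y : d₁ y = 1 := by simpa [h01, h11] using h1y 1
  -- The tables below give both derivations on every monomial, rewritten in the monomials themselves
  -- by means of the quadratic relations.
  have e0y2 : d₀ (y * y) = ((1 - ξ) / 2) • x := by simp [h0y, e0y, e1y]
  have e1y2 : d₁ (y * y) = 0 := by simp [h1y, e1y]
  have e0y3 : d₀ (y * (y * y)) = -((1 + ξ) / 2) • (x * y) := by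
    rw [h0y, e0y2, e1y2, mul_smul_comm, hyx, mul_zero, smul_zero, add_zero]
    match_scalars
    field_simp
    linear_combination hξ
  have e1y3 : d₁ (y * (y * y)) = y * y := by rw [h1y, e1y2, mul_zero, sub_zero]
  have e0xy : d₀ (x * y) = -ξ • y := by
    simp only [h0x, e0y, e1y, mul_zero, mul_one, smul_zero]
    module
  have e1xy : d₁ (x * y) = -x := by simp [h1x, e1y]
  have e0xy2 : d₀ (x * (y * y)) = -ξ • (y * y) := by
    simp only [h0x, e0y2, e1y2, mul_zero, mul_smul_comm, smul_zero, hxx, two_mul]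
    match_scalars
    field_simp
    linear_combination 2 * hξ
  have e1xy2 : d₁ (x * (y * y)) = 0 := by simp [h1x, e1y2]
  have e0xy3 : d₀ (x * (y * (y * y))) = -(y * (y * y)) := by
    simp only [h0x, e0y3, e1y3, mul_smul_comm, hxx', two_mul]
    match_scalars
    field_simp
    linear_combination hξ
  have e1xy3 : d₁ (x * (y * (y * y))) = -(x * (y * y)) := by simp [h1x, e1y3]
  rw [Fintype.linearIndependent_iff]
  intro g hg
  have hg' : g (0, 0) • (1 : B) + g (0, 1) • y + g (0, 2) • (y * y) + g (0, 3) • (y * (y * y)) +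
      (g (1, 0) • x + g (1, 1) • (x * y) + g (1, 2) • (x * (y * y)) +
        g (1, 3) • (x * (y * (y * y)))) = 0 := by
    simpa [monomials, Fintype.sum_prod_type, Fin.sum_univ_four, pow_two, pow_three] using hg
  -- The words are chosen so that each functional is nonzero on exactly one monomial, making the
  -- evaluation matrix diagonal. The entries are `1` or `-1` up to the factors `ξ` and `(1 - ξ) /
  -- 2`.
  have c00 := congrArg ε hg'
  have c10 := congrArg (fun u => ε (d₀ u)) hg'
  have c01 := congrArg (fun u => ε (d₁ u)) hg'
  have c11 := congrArg (fun u => ε (d₀ (d₁ u))) hg'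
  have c02 := congrArg (fun u => ε (d₀ (d₀ u))) hg'
  have c03 := congrArg (fun u => ε (d₀ (d₀ (d₁ u)))) hg'
  have c12 := congrArg (fun u => ε (d₀ (d₀ (d₀ u)))) hg'
  have c13 := congrArg (fun u => ε (d₀ (d₀ (d₁ (d₀ u))))) hg'
  -- The quotient `(1 - ξ) / 2` must stay unsplit for `hne` to cancel it.
  simp [h01, h11, e0x, e1x, e0y, e1y, e0y2, e1y2, e0y3, e1y3, e0xy, e1xy, e0xy2, e1xy2, e0xy3,
    e1xy3, hε1, hεx, hεy, hex, hey, -div_eq_zero_iff, hne, hξ0]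
    at c00 c10 c01 c11 c02 c03 c12 c13
  rintro ⟨i, j⟩
  fin_cases i <;> fin_cases j <;> assumption

end SkewDerivations

end KHopf

/-! ### Braided products, contractions and coideals in general tensor algebras -/

namespace YetterDrinfeldModule

variable {k H V : Type*} [Field k] [Ring H] [HopfAlgebra k H] [AddCommGroup V] [Module k V]
  (M : YetterDrinfeldModule k H V)

lemma tensorAct_one_left (t : TensorAlgebra k V) : M.tensorAct 1 t = t := by
  induction t using TensorAlgebra.induction with
  | algebraMap r =>
    rw [Algebra.algebraMap_eq_smul_one, map_smul, tensorAct_one]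
    simp
  | ι v => simp [tensorAct_ι]
  | mul s t hs ht =>
    rw [tensorAct_mul]
    simp [Algebra.TensorProduct.one_def, hs, ht]
  | add s t hs ht => rw [map_add, hs, ht]

lemma tensorCoact_ι (v : V) : M.tensorCoact (TensorAlgebra.ι k v) =
    (TensorAlgebra.ι k).lTensor H (M.coact v) := by
  simp [tensorCoact]

lemma braidedMul_tmul_one (s r t : TensorAlgebra k V) :
    M.braidedMul (s ⊗ₜ 1) (r ⊗ₜ t) = (s * r) ⊗ₜ t := by
  simp [braidedMul, tensorBraiding, Algebra.TensorProduct.one_def, tensorAct_one_left]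

lemma braidedMul_one_tmul_ι (v : V) (r t : TensorAlgebra k V) :
    M.braidedMul (1 ⊗ₜ TensorAlgebra.ι k v) (r ⊗ₜ t) =
      TensorProduct.map (M.tensorAct.flip r)
        (LinearMap.mulRight k t ∘ₗ TensorAlgebra.ι k) (M.coact v) := by
  simp only [braidedMul, tensorBraiding, TensorProduct.curry_apply, LinearMap.comp_apply,
    LinearEquiv.coe_coe, LinearMap.rTensor_tmul, LinearMap.lTensor_tmul,
    TensorProduct.tensorTensorTensorAssoc_tmul, AlgHom.toLinearMap_apply, tensorCoact_ι]
  -- The claim is linear in the coaction, so pure tensors suffice.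
  generalize M.coact v = z
  induction z with
  | zero => simp
  | add z w hz hw => simp only [map_add, TensorProduct.add_tmul, TensorProduct.tmul_add, hz, hw]
  | tmul h u => simp

/-- Contraction of the first tensor factor with a linear functional. -/
def contract (f : TensorAlgebra k V →ₗ[k] k) :
    TensorAlgebra k V ⊗[k] TensorAlgebra k V →ₗ[k] TensorAlgebra k V :=
  (TensorProduct.lid k _).toLinearMap ∘ₗ f.rTensor _

@[simp]
lemma contract_tmul (f : TensorAlgebra k V →ₗ[k] k) (s t : TensorAlgebra k V) :
    contract f (s ⊗ₜ t) = f s • t := by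
  simp [contract]

/-- The generators have degree at least two, and products of two vectors vanish in `k ⊕ V`. Hence
every functional that reads only the constant and linear parts vanishes on the Nichols ideal. -/
lemma nicholsIdeal_le_ker_toTrivSqZeroExt [Module kᵐᵒᵖ V] [IsCentralScalar k V] :
    M.nicholsIdeal ≤
      TwoSidedIdeal.ker (TensorAlgebra.toTrivSqZeroExt : TensorAlgebra k V →ₐ[k] _) := by
  obtain ⟨⟨S, hS, h⟩, -⟩ := M.isGreatest_nicholsIdeal.1
  rw [h, TwoSidedIdeal.span_le]
  intro s hs
  obtain ⟨n, hn, hsn⟩ := hS s hs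
  obtain ⟨m, rfl⟩ := Nat.exists_eq_add_of_le hn
  rw [SetLike.mem_coe, TwoSidedIdeal.mem_ker]
  have hle : (LinearMap.range (TensorAlgebra.ι k : V →ₗ[k] TensorAlgebra k V) ^ (2 + m)).map
      (TensorAlgebra.toTrivSqZeroExt : TensorAlgebra k V →ₐ[k] _).toLinearMap ≤ ⊥ := by
    rw [pow_add, Submodule.map_mul, pow_two, Submodule.map_mul]
    suffices h0 : (LinearMap.range (TensorAlgebra.ι k : V →ₗ[k] TensorAlgebra k V)).map
        (TensorAlgebra.toTrivSqZeroExt : TensorAlgebra k V →ₐ[k] _).toLinearMap *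
        (LinearMap.range (TensorAlgebra.ι k : V →ₗ[k] TensorAlgebra k V)).map
        (TensorAlgebra.toTrivSqZeroExt : TensorAlgebra k V →ₐ[k] _).toLinearMap ≤ ⊥ by
      rw [le_bot_iff.1 h0, Submodule.bot_mul]
    rw [Submodule.mul_le]
    rintro _ ⟨_, ⟨v, rfl⟩, rfl⟩ _ ⟨_, ⟨w, rfl⟩, rfl⟩
    simp
  simpa using hle ⟨s, hsn, rfl⟩

/-- Contracting the comultiplication with a functional that vanishes on the defining ideal of the
Nichols algebra preserves this ideal. -/
lemma contract_braidedComul_mem {f : TensorAlgebra k V →ₗ[k] k}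
    (hf : ∀ t ∈ M.nicholsIdeal, f t = 0) {t : TensorAlgebra k V} (ht : t ∈ M.nicholsIdeal) :
    contract f (M.braidedComul t) ∈ M.nicholsIdeal := by
  have hle : LinearMap.range ((idealSubmodule (k := k) M.nicholsIdeal).subtype.rTensor
        (TensorAlgebra k V)) ⊔
      LinearMap.range ((idealSubmodule (k := k) M.nicholsIdeal).subtype.lTensor
        (TensorAlgebra k V)) ≤
      (idealSubmodule (k := k) M.nicholsIdeal).comap (contract f) := by
    refine sup_le ?_ ?_ <;> rintro _ ⟨z, rfl⟩ <;> rw [Submodule.mem_comap]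
    · induction z with
      | zero => simp
      | add z w hz hw => simpa only [map_add] using Submodule.add_mem _ hz hw
      | tmul s t => simp [hf s s.2]
    · induction z with
      | zero => simp
      | add z w hz hw => simpa only [map_add] using Submodule.add_mem _ hz hw
      | tmul s t => simpa using Submodule.smul_mem _ (f s) t.2
  exact hle (M.isGreatest_nicholsIdeal.1.2 t ht)

/-- A criterion for the coideal condition, in terms of a surjection with kernel `I`. -/
lemma braidedComul_mem_of_map_eq_zero {R : Type*} [Ring R] [Algebra k R]
    {I : TwoSidedIdeal (TensorAlgebra k V)} {π : TensorAlgebra k V →ₐ[k] R}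
    (hπ : Function.Surjective π) (hI : ∀ t, π t = 0 ↔ t ∈ I)
    {z : TensorAlgebra k V ⊗[k] TensorAlgebra k V}
    (hz : TensorProduct.map π.toLinearMap π.toLinearMap z = 0) :
    z ∈ LinearMap.range ((idealSubmodule (k := k) I).subtype.rTensor (TensorAlgebra k V)) ⊔
      LinearMap.range ((idealSubmodule (k := k) I).subtype.lTensor (TensorAlgebra k V)) := by
  have hex : Function.Exact (idealSubmodule (k := k) I).subtype π.toLinearMap := by
    intro t
    exact (hI t).trans ⟨fun h => ⟨⟨t, h⟩, rfl⟩, by rintro ⟨s, rfl⟩; exact s.2⟩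
  -- Right exactness of the tensor product: the kernel of `π ⊗ π` is the sum of the two ranges.
  rw [sup_comm, ← TensorProduct.map_ker hex hπ hex hπ]
  exact hz

end YetterDrinfeldModule

/-! ### The relation ideal and the maps that kill it -/

namespace KHopf

/-- The two-sided ideal generated by the defining relations of the Nichols algebra. -/
def relationIdeal {A : Type*} [Ring A] (x y : A) : TwoSidedIdeal A :=
  TwoSidedIdeal.span {x ^ 2 - 2 * y ^ 2, x * y + y * x, y ^ 4}

lemma relationIdeal_le_ker {A S F : Type*} [Ring A] [Ring S] [FunLike F A S] [RingHomClass F A S]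
    (f : F) {x y : A} (hxx : f x * f x = 2 * (f y * f y)) (hyx : f y * f x = -(f x * f y))
    (hy4 : f y ^ 4 = 0) : relationIdeal x y ≤ TwoSidedIdeal.ker f := by
  rw [relationIdeal, TwoSidedIdeal.span_le]
  rintro _ (rfl | rfl | rfl) <;> rw [SetLike.mem_coe, TwoSidedIdeal.mem_ker]
  · rw [map_sub, map_mul, map_pow, map_pow, pow_two, pow_two, hxx, map_ofNat, sub_self]
  · rw [map_add, map_mul, map_mul, hyx, add_neg_cancel]
  · rw [map_pow, hy4]

lemma relations_of_relationIdeal_le_ker {A S F : Type*} [Ring A] [Ring S] [FunLike F A S]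
    [RingHomClass F A S] (f : F) {x y : A} (h : relationIdeal x y ≤ TwoSidedIdeal.ker f) :
    f x * f x = 2 * (f y * f y) ∧ f y * f x = -(f x * f y) ∧ f y ^ 4 = 0 := by
  have hs : ∀ r ∈ ({x ^ 2 - 2 * y ^ 2, x * y + y * x, y ^ 4} : Set A), f r = 0 := fun r hr =>
    (TwoSidedIdeal.mem_ker f).1 (h (TwoSidedIdeal.subset_span hr))
  refine ⟨?_, ?_, ?_⟩
  · have := hs (x ^ 2 - 2 * y ^ 2) (by simp)
    rwa [map_sub, map_mul, map_pow, map_pow, pow_two, pow_two, map_ofNat, sub_eq_zero] at this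
  · have := hs (x * y + y * x) (by simp)
    rwa [map_add, map_mul, map_mul, add_comm, add_eq_zero_iff_eq_neg] at this
  · rw [← map_pow]
    exact hs (y ^ 4) (by simp)

variable {k : Type*} [Field k] (ξ : k)

/-- The basis vectors of `V_{3,3}` in the tensor algebra. -/
abbrev basisι (k : Type*) [Field k] (i : Fin 2) : TensorAlgebra k (Fin 2 → k) :=
  TensorAlgebra.ι k (Pi.single i 1)

lemma adjoin_basisι : Algebra.adjoin k {basisι k 0, basisι k 1} = ⊤ := by
  rw [eq_top_iff, ← TensorAlgebra.adjoin_range_ι, Algebra.adjoin_le_iff]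
  rintro _ ⟨v, rfl⟩
  have hv : v = v 0 • Pi.single 0 1 + v 1 • Pi.single 1 1 := by
    ext i; fin_cases i <;> simp
  rw [hv, map_add, map_smul, map_smul]
  exact add_mem (Subalgebra.smul_mem _ (Algebra.subset_adjoin (by simp)) _)
    (Subalgebra.smul_mem _ (Algebra.subset_adjoin (by simp)) _)

/-- The algebra map from the tensor algebra sending the basis vectors to given elements. -/
def liftBasis {A : Type*} [Ring A] [Algebra k A] (f : Fin 2 → A) :
    TensorAlgebra k (Fin 2 → k) →ₐ[k] A :=
  TensorAlgebra.lift k (Fintype.linearCombination k f)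

@[simp]
lemma liftBasis_basisι {A : Type*} [Ring A] [Algebra k A] (f : Fin 2 → A) (i : Fin 2) :
    liftBasis f (basisι k i) = f i := by
  simp [liftBasis, Fintype.linearCombination_apply]

lemma map_adjoin_eq_top {A : Type*} [Ring A] [Algebra k A]
    {π : TensorAlgebra k (Fin 2 → k) →ₐ[k] A} (hπ : Function.Surjective π) :
    Algebra.adjoin k {π (basisι k 0), π (basisι k 1)} = ⊤ := by
  rw [← Set.image_pair, ← AlgHom.map_adjoin, adjoin_basisι, Algebra.map_top]
  exact (AlgHom.range_eq_top π).2 hπ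

variable {ξ} in
-- This makes the relation ideal stable under `a, b, c, d`. The squares of the two matrices are the
-- scalar matrices `-x²` and `-y²`, so all relations reduce to those in `R`.
lemma relationIdeal_le_ker_actMatrix {R : Type*} [Ring R] [Algebra k R] {x y : R}
    (hξ : ξ * ξ = -1) (hxx : x * x = 2 * (y * y)) (hyx : y * x = -(x * y)) (hy4 : y ^ 4 = 0) :
    relationIdeal (basisι k 0) (basisι k 1) ≤
      TwoSidedIdeal.ker (liftBasis (k := k) (actMatrix ξ x y)) := by
  have hx0 : actMatrix ξ x y 0 * actMatrix ξ x y 0 = !![-(x * x), 0; 0, -(x * x)] := by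
    simp [actMatrix, smul_smul, hξ]
  have hy0 : actMatrix ξ x y 1 * actMatrix ξ x y 1 = !![-(y * y), 0; 0, -(y * y)] := by
    simp [actMatrix, hyx, hxx, two_mul]
  refine relationIdeal_le_ker _ ?_ ?_ ?_ <;> simp only [liftBasis_basisι]
  · rw [hx0, hy0, hxx, two_mul, two_mul]
    simp [neg_add_rev]
  · simp [actMatrix, hyx]
  · rw [show 4 = 2 * 2 from rfl, pow_mul, pow_two (actMatrix ξ x y 1), hy0, pow_two]
    have h : y * y * (y * y) = 0 := by rw [← hy4, ← pow_two, ← pow_two, ← pow_mul]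
    ext i j
    fin_cases i <;> fin_cases j <;> simp [h]

variable {ξ} in
lemma relationIdeal_le_ker_braidedLeft {R : Type*} [Ring R] [Algebra k R] {x y : R}
    {ρ : R →ₐ[k] Matrix (Fin 2) (Fin 2) R} (h2 : (2 : k) ≠ 0) (hξ : ξ * ξ = -1)
    (hgen : Algebra.adjoin k {x, y} = ⊤)
    (hx : ρ x = actMatrix ξ x y 0) (hy : ρ y = actMatrix ξ x y 1)
    (hxx : x * x = (2 : k) • (y * y)) (hyx : y * x = -(x * y)) (hy4 : y ^ 4 = 0) :
    relationIdeal (basisι k 0) (basisι k 1) ≤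
      TwoSidedIdeal.ker (liftBasis (k := k) ![braidedLeftX ξ ρ x y, braidedLeftY ξ ρ x y]) := by
  refine relationIdeal_le_ker _ ?_ ?_ ?_ <;>
    simp only [liftBasis_basisι, Matrix.cons_val_zero, Matrix.cons_val_one]
  · rw [two_mul, ← two_smul k]
    exact braidedLeft_sq h2 hξ hgen hx hy hxx hyx
  · rw [eq_neg_iff_add_eq_zero, add_comm]
    exact braidedLeft_anticomm h2 hξ hgen hx hy hxx hyx
  · exact braidedLeftY_pow_four h2 hξ hgen hx hy hxx hyx hy4

/-! ### The relation ideal is a coideal -/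

/-- The generators of `𝒦` arranged in a matrix. -/
def genIndex : Fin 2 → Fin 2 → KGen := ![![.a, .b], ![.c, .d]]

variable [hξ : Fact (IsPrimitiveRoot ξ 4)]

lemma comul_genIndex (i j : Fin 2) : Coalgebra.comul (R := k) (gen ξ (genIndex i j)) =
    gen ξ (genIndex i 0) ⊗ₜ gen ξ (genIndex 0 j) +
      gen ξ (genIndex i 1) ⊗ₜ gen ξ (genIndex 1 j) := by
  rw [comul_gen]
  fin_cases i <;> fin_cases j <;> rfl

lemma counit_genIndex (i j : Fin 2) : Coalgebra.counit (R := k) (gen ξ (genIndex i j)) =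
    if i = j then (1 : k) else 0 := by
  rw [counit_gen]
  fin_cases i <;> fin_cases j <;> rfl

lemma tensorAct_genIndex_mul (i j : Fin 2) (s t : TensorAlgebra k (Fin 2 → k)) :
    (V33 ξ).tensorAct (gen ξ (genIndex i j)) (s * t) =
      (V33 ξ).tensorAct (gen ξ (genIndex i 0)) s * (V33 ξ).tensorAct (gen ξ (genIndex 0 j)) t +
      (V33 ξ).tensorAct (gen ξ (genIndex i 1)) s * (V33 ξ).tensorAct (gen ξ (genIndex 1 j)) t := by
  rw [YetterDrinfeldModule.tensorAct_mul, comul_genIndex]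
  simp

lemma tensorAct_genIndex_basisι (i j l : Fin 2) :
    (V33 ξ).tensorAct (gen ξ (genIndex i j)) (basisι k l) =
      actMatrix ξ (basisι k 0) (basisι k 1) l i j := by
  rw [YetterDrinfeldModule.tensorAct_ι]
  fin_cases i <;> fin_cases j <;> fin_cases l <;>
    simp [V33, genIndex, actMatrix, v33Act_a_0, v33Act_a_1, v33Act_b_0, v33Act_b_1, v33Act_c_0,
      v33Act_c_1, v33Act_d_0, v33Act_d_1]

variable {ξ}

/-- Both sides obey the same matrix product rule and agree on `1` and on the basis vectors, so `π`
is equivariant for the action encoded by `ρ`. -/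
lemma map_tensorAct {R : Type*} [Ring R] [Algebra k R] (π : TensorAlgebra k (Fin 2 → k) →ₐ[k] R)
    {ρ : R →ₐ[k] Matrix (Fin 2) (Fin 2) R}
    (hρ : ∀ i, ρ (π (basisι k i)) = actMatrix ξ (π (basisι k 0)) (π (basisι k 1)) i)
    (t : TensorAlgebra k (Fin 2 → k)) (i j : Fin 2) :
    π ((V33 ξ).tensorAct (gen ξ (genIndex i j)) t) = entry ρ i j (π t) := by
  have hbase : ∀ l i j, π ((V33 ξ).tensorAct (gen ξ (genIndex i j)) (basisι k l)) =
      entry ρ i j (π (basisι k l)) := by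
    intro l i j
    rw [tensorAct_genIndex_basisι, entry_apply, hρ]
    fin_cases i <;> fin_cases j <;> fin_cases l <;> simp [actMatrix]
  let p : Submodule k (TensorAlgebra k (Fin 2 → k)) :=
    { carrier := {t | ∀ i j,
        π ((V33 ξ).tensorAct (gen ξ (genIndex i j)) t) = entry ρ i j (π t)}
      zero_mem' := by simp
      add_mem' := fun hs ht i j => by simp only [map_add, hs i j, ht i j]
      smul_mem' := fun c t ht i j => by simp only [map_smul, ht i j] }
  have hmul : ∀ l, ∀ t ∈ p, basisι k l * t ∈ p := fun l t ht i j => by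
    rw [tensorAct_genIndex_mul, map_add, map_mul, map_mul, map_mul, entry_mul, hbase, hbase, ht, ht]
  have hp : p = ⊤ := by
    refine eq_top_of_mul_mem adjoin_basisι p (fun i j => ?_) (hmul 0) (hmul 1)
    rw [YetterDrinfeldModule.tensorAct_one, counit_genIndex, map_one, entry_one]
    split_ifs <;> simp
  exact (hp ▸ Submodule.mem_top : t ∈ p) i j

lemma braidedMul_basisι_zero (r t : TensorAlgebra k (Fin 2 → k)) :
    (V33 ξ).braidedMul (basisι k 0 ⊗ₜ 1 + 1 ⊗ₜ basisι k 0) (r ⊗ₜ t) =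
      (basisι k 0 * r) ⊗ₜ t +
        ((V33 ξ).tensorAct (gen ξ (genIndex 0 0)) r ⊗ₜ (basisι k 0 * t) +
          (1 + ξ) • (V33 ξ).tensorAct (gen ξ (genIndex 0 1)) r ⊗ₜ (basisι k 1 * t)) := by
  rw [map_add, LinearMap.add_apply, YetterDrinfeldModule.braidedMul_tmul_one,
    YetterDrinfeldModule.braidedMul_one_tmul_ι]
  change _ + TensorProduct.map _ _ (v33Coact ξ _) = _
  simp [v33Coact_0, genIndex, TensorProduct.smul_tmul']

lemma braidedMul_basisι_one (r t : TensorAlgebra k (Fin 2 → k)) :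
    (V33 ξ).braidedMul (basisι k 1 ⊗ₜ 1 + 1 ⊗ₜ basisι k 1) (r ⊗ₜ t) =
      (basisι k 1 * r) ⊗ₜ t +
        ((V33 ξ).tensorAct (gen ξ (genIndex 1 1)) r ⊗ₜ (basisι k 1 * t) +
          ((1 - ξ) / 2) • (V33 ξ).tensorAct (gen ξ (genIndex 1 0)) r ⊗ₜ (basisι k 0 * t)) := by
  rw [map_add, LinearMap.add_apply, YetterDrinfeldModule.braidedMul_tmul_one,
    YetterDrinfeldModule.braidedMul_one_tmul_ι]
  change _ + TensorProduct.map _ _ (v33Coact ξ _) = _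
  simp [v33Coact_1, genIndex, TensorProduct.smul_tmul']

/-- The comultiplication, pushed forward along an algebra map `π`, is computed by the operators of
braided left multiplication. -/
lemma map_braidedComul {R : Type*} [Ring R] [Algebra k R]
    (π : TensorAlgebra k (Fin 2 → k) →ₐ[k] R) {ρ : R →ₐ[k] Matrix (Fin 2) (Fin 2) R}
    (hρ : ∀ i, ρ (π (basisι k i)) = actMatrix ξ (π (basisι k 0)) (π (basisι k 1)) i)
    (t : TensorAlgebra k (Fin 2 → k)) :
    TensorProduct.map π.toLinearMap π.toLinearMap ((V33 ξ).braidedComul t) =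
      liftBasis ![braidedLeftX ξ ρ (π (basisι k 0)) (π (basisι k 1)),
        braidedLeftY ξ ρ (π (basisι k 0)) (π (basisι k 1))] t (1 ⊗ₜ 1) := by
  set Λ := liftBasis (k := k) ![braidedLeftX ξ ρ (π (basisι k 0)) (π (basisι k 1)),
        braidedLeftY ξ ρ (π (basisι k 0)) (π (basisι k 1))] with hΛ
  have hmul : ∀ i z, TensorProduct.map π.toLinearMap π.toLinearMap
      ((V33 ξ).braidedMul (basisι k i ⊗ₜ 1 + 1 ⊗ₜ basisι k i) z) =
      Λ (basisι k i) (TensorProduct.map π.toLinearMap π.toLinearMap z) := by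
    intro i z
    induction z with
    | zero => simp
    | add z w hz hw =>
      rw [map_add _ z w, map_add (TensorProduct.map π.toLinearMap π.toLinearMap), hz, hw,
        map_add (TensorProduct.map π.toLinearMap π.toLinearMap) z w, map_add (Λ _)]
    | tmul r s =>
      rw [hΛ, liftBasis_basisι]
      fin_cases i
      · simp only [Fin.zero_eta, braidedMul_basisι_zero]
        simp [braidedLeftX_tmul, map_tensorAct π hρ]
      · simp only [Fin.mk_one, braidedMul_basisι_one]
        simp [braidedLeftY_tmul, map_tensorAct π hρ]
  let p := LinearMap.eqLocus
    (TensorProduct.map π.toLinearMap π.toLinearMap ∘ₗ (V33 ξ).braidedComul)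
    (Λ.toLinearMap.flip (1 ⊗ₜ 1))
  have hstep : ∀ i, ∀ t ∈ p, basisι k i * t ∈ p := by
    intro i t ht
    rw [LinearMap.mem_eqLocus] at ht ⊢
    simp only [LinearMap.comp_apply, LinearMap.flip_apply, AlgHom.toLinearMap_apply] at ht ⊢
    rw [YetterDrinfeldModule.braidedComul_ι_mul, hmul, ht, map_mul, Module.End.mul_apply]
  have hp : p = ⊤ := by
    refine eq_top_of_mul_mem adjoin_basisι p ?_ (hstep 0) (hstep 1)
    rw [LinearMap.mem_eqLocus]
    simp [YetterDrinfeldModule.braidedComul_one]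
  exact (hp ▸ Submodule.mem_top : t ∈ p)

variable (ξ)

lemma relationIdeal_mem_coidealIdeals (h2 : (2 : k) ≠ 0) :
    relationIdeal (basisι k 0) (basisι k 1) ∈ (V33 ξ).coidealIdeals := by
  have hx := xi_mul_xi hξ.out
  refine ⟨⟨_, ?_, rfl⟩, ?_⟩
  · have hmem : ∀ i, basisι k i ∈ LinearMap.range (TensorAlgebra.ι k : (Fin 2 → k) →ₗ[k] _) :=
      fun i => ⟨_, rfl⟩
    rintro _ (rfl | rfl | rfl)
    · refine ⟨2, le_rfl, sub_mem (Submodule.pow_mem_pow _ (hmem 0) 2) ?_⟩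
      rw [two_mul]
      exact add_mem (Submodule.pow_mem_pow _ (hmem 1) 2) (Submodule.pow_mem_pow _ (hmem 1) 2)
    · refine ⟨2, le_rfl, ?_⟩
      rw [YetterDrinfeldModule.tensorDegree, pow_two]
      exact add_mem (Submodule.mul_mem_mul (hmem 0) (hmem 1))
        (Submodule.mul_mem_mul (hmem 1) (hmem 0))
    · exact ⟨4, by omega, Submodule.pow_mem_pow _ (hmem 1) 4⟩
  intro t ht
  set I := relationIdeal (basisι k 0) (basisι k 1) with hI
  let π := Ideal.Quotient.mkₐ k (TwoSidedIdeal.asIdeal I)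
  have hπ : Function.Surjective π := Ideal.Quotient.mkₐ_surjective k _
  have hker : ∀ t, π t = 0 ↔ t ∈ I := fun t => Ideal.Quotient.eq_zero_iff_mem
  obtain ⟨hxx, hyx, hy4⟩ := relations_of_relationIdeal_le_ker π (x := basisι k 0) (y := basisι k 1)
    fun t ht => (TwoSidedIdeal.mem_ker π).2 ((hker t).2 ht)
  set x := π (basisι k 0) with hxdef
  set y := π (basisι k 1) with hydef
  have hxx' : x * x = (2 : k) • (y * y) := by rw [hxx, two_mul, two_smul]
  have hρI : I ≤ TwoSidedIdeal.ker (liftBasis (k := k) (actMatrix ξ x y)) :=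
    relationIdeal_le_ker_actMatrix hx hxx hyx hy4
  -- The action descends to the quotient as a map to matrices over the quotient itself.
  let ρ := Ideal.Quotient.liftₐ (TwoSidedIdeal.asIdeal I) (liftBasis (k := k) (actMatrix ξ x y))
    fun t ht => (TwoSidedIdeal.mem_ker _).1 (hρI ht)
  have hρ : ∀ i, ρ (π (basisι k i)) = actMatrix ξ x y i := fun i =>
    liftBasis_basisι (k := k) (actMatrix ξ x y) i
  refine YetterDrinfeldModule.braidedComul_mem_of_map_eq_zero hπ hker ?_
  rw [map_braidedComul π hρ]
  have hΛI := relationIdeal_le_ker_braidedLeft h2 hx (map_adjoin_eq_top hπ)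
    (hρ 0) (hρ 1) hxx' hyx hy4
  rw [(TwoSidedIdeal.mem_ker _).1 (hΛI ht), LinearMap.zero_apply]

/-! ### Skew derivations of the tensor algebra and their descent -/

open YetterDrinfeldModule

variable {k : Type*} [Field k] (ξ : k) [hξ : Fact (IsPrimitiveRoot ξ 4)]

/-- The augmentation of the tensor algebra. -/
def augment (k : Type*) [Field k] : TensorAlgebra k (Fin 2 → k) →ₗ[k] k :=
  (TrivSqZeroExt.fstHom k k (Fin 2 → k)).toLinearMap ∘ₗ TensorAlgebra.toTrivSqZeroExt.toLinearMap

/-- The coordinates of the degree one component of an element of the tensor algebra. -/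
def degreeOneCoord (k : Type*) [Field k] (i : Fin 2) : TensorAlgebra k (Fin 2 → k) →ₗ[k] k :=
  LinearMap.proj i ∘ₗ TrivSqZeroExt.sndHom k (Fin 2 → k) ∘ₗ
    TensorAlgebra.toTrivSqZeroExt.toLinearMap

@[simp] lemma augment_one : augment k 1 = 1 := by simp [augment]

@[simp] lemma augment_basisι_mul (i : Fin 2) (t : TensorAlgebra k (Fin 2 → k)) :
    augment k (basisι k i * t) = 0 := by simp [augment]

@[simp] lemma degreeOneCoord_one (i : Fin 2) : degreeOneCoord k i 1 = 0 := by simp [degreeOneCoord]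

lemma degreeOneCoord_basisι_mul (i j : Fin 2) (t : TensorAlgebra k (Fin 2 → k)) :
    degreeOneCoord k i (basisι k j * t) = if i = j then augment k t else 0 := by
  simp [degreeOneCoord, augment, Pi.single_apply]

lemma degreeOneCoord_basisι (i j : Fin 2) :
    degreeOneCoord k i (basisι k j) = if i = j then 1 else 0 := by
  simpa using degreeOneCoord_basisι_mul i j (1 : TensorAlgebra k (Fin 2 → k))

variable {ξ} in
lemma augment_tensorAct (t : TensorAlgebra k (Fin 2 → k)) (i j : Fin 2) :
    augment k ((V33 ξ).tensorAct (gen ξ (genIndex i j)) t) =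
      if i = j then augment k t else 0 := by
  let p : Submodule k (TensorAlgebra k (Fin 2 → k)) := LinearMap.eqLocus
    (augment k ∘ₗ (V33 ξ).tensorAct (gen ξ (genIndex i j))) (if i = j then augment k else 0)
  have hmul : ∀ l, ∀ t ∈ p, basisι k l * t ∈ p := fun l t ht => by
    rw [LinearMap.mem_eqLocus] at ht ⊢
    rw [LinearMap.comp_apply, tensorAct_genIndex_mul, tensorAct_genIndex_basisι,
      tensorAct_genIndex_basisι]
    fin_cases i <;> fin_cases j <;> fin_cases l <;> simp [actMatrix]
  have hp : p = ⊤ := by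
    refine eq_top_of_mul_mem adjoin_basisι p ?_ (hmul 0) (hmul 1)
    rw [LinearMap.mem_eqLocus, LinearMap.comp_apply, tensorAct_one, counit_genIndex]
    split_ifs <;> simp
  have h := (hp ▸ Submodule.mem_top : t ∈ p)
  rw [LinearMap.mem_eqLocus, LinearMap.comp_apply] at h
  rw [h]
  split_ifs <;> rfl

variable {ξ} in
-- The action preserves degree, so the linear part of `h · t` is `h` applied to the linear part of
-- `t`; the coefficients are the matrix entries of `h` on `V`.
lemma degreeOneCoord_tensorAct (t : TensorAlgebra k (Fin 2 → k)) (i j l : Fin 2) :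
    degreeOneCoord k l ((V33 ξ).tensorAct (gen ξ (genIndex i j)) t) =
      degreeOneCoord k l (actMatrix ξ (basisι k 0) (basisι k 1) 0 i j) * degreeOneCoord k 0 t +
      degreeOneCoord k l (actMatrix ξ (basisι k 0) (basisι k 1) 1 i j) * degreeOneCoord k 1 t := by
  let p : Submodule k (TensorAlgebra k (Fin 2 → k)) := LinearMap.eqLocus
    (degreeOneCoord k l ∘ₗ (V33 ξ).tensorAct (gen ξ (genIndex i j)))
    (degreeOneCoord k l (actMatrix ξ (basisι k 0) (basisι k 1) 0 i j) • degreeOneCoord k 0 +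
      degreeOneCoord k l (actMatrix ξ (basisι k 0) (basisι k 1) 1 i j) • degreeOneCoord k 1)
  -- The linear part of `basisι k m * t` sees only the constant term of `t`, so `augment_tensorAct`
  -- settles it.
  have hmul : ∀ m, ∀ t ∈ p, basisι k m * t ∈ p := fun m t _ => by
    rw [LinearMap.mem_eqLocus, LinearMap.comp_apply, tensorAct_genIndex_mul,
      tensorAct_genIndex_basisι, tensorAct_genIndex_basisι]
    simp only [LinearMap.add_apply, LinearMap.smul_apply, smul_eq_mul]
    fin_cases i <;> fin_cases j <;> fin_cases m <;> fin_cases l <;>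
      simp [actMatrix, degreeOneCoord_basisι_mul, degreeOneCoord_basisι, augment_tensorAct]
  have hp : p = ⊤ := by
    refine eq_top_of_mul_mem adjoin_basisι p ?_ (hmul 0) (hmul 1)
    rw [LinearMap.mem_eqLocus, LinearMap.comp_apply, tensorAct_one, counit_genIndex]
    split_ifs <;> simp
  exact (hp ▸ Submodule.mem_top : t ∈ p)

variable {ξ} in
-- The left counit law of the braided Hopf algebra; it supplies the untwisted term `t` in the
-- Leibniz rules.
lemma contract_augment_braidedComul (t : TensorAlgebra k (Fin 2 → k)) :
    contract (augment k) ((V33 ξ).braidedComul t) = t := by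
  have hmul : ∀ i z, contract (augment k)
      ((V33 ξ).braidedMul (basisι k i ⊗ₜ 1 + 1 ⊗ₜ basisι k i) z) =
      basisι k i * contract (augment k) z := by
    intro i z
    induction z with
    | zero => simp
    | add z w hz hw =>
      rw [map_add _ z w, map_add (contract (augment k)), hz, hw,
        map_add (contract (augment k)) z w, mul_add]
    | tmul r s =>
      fin_cases i
      · simp only [Fin.zero_eta, braidedMul_basisι_zero]
        simp [augment_tensorAct]
      · simp only [Fin.mk_one, braidedMul_basisι_one]
        simp [augment_tensorAct]
  let p := LinearMap.eqLocus (contract (augment k) ∘ₗ (V33 ξ).braidedComul) LinearMap.id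
  have hstep : ∀ i, ∀ t ∈ p, basisι k i * t ∈ p := by
    intro i t ht
    rw [LinearMap.mem_eqLocus, LinearMap.comp_apply, LinearMap.id_apply] at ht ⊢
    rw [braidedComul_ι_mul, hmul, ht]
  have hp : p = ⊤ := by
    refine eq_top_of_mul_mem adjoin_basisι p ?_ (hstep 0) (hstep 1)
    rw [LinearMap.mem_eqLocus]
    simp [braidedComul_one]
  exact (hp ▸ Submodule.mem_top : t ∈ p)

/-- The skew derivations of the tensor algebra dual to the basis of `V_{3,3}`. -/
def skewDer (i : Fin 2) : TensorAlgebra k (Fin 2 → k) →ₗ[k] TensorAlgebra k (Fin 2 → k) :=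
  contract (degreeOneCoord k i) ∘ₗ (V33 ξ).braidedComul

lemma skewDer_one (i : Fin 2) : skewDer ξ i 1 = 0 := by
  simp [skewDer, braidedComul_one]

/-- Twisted Leibniz rule: the summand `x ⊗ 1` of `Δ(x)` gives `t`, while `1 ⊗ x` gives the others,
with coefficients read off from the coaction of `x` and the action of `a` and `b` on `V`. -/
lemma skewDer_basisι_zero_mul (t : TensorAlgebra k (Fin 2 → k)) :
    skewDer ξ 0 (basisι k 0 * t) =
      t - ξ • (basisι k 0 * skewDer ξ 0 t) - (1 + ξ) • (basisι k 1 * skewDer ξ 1 t) ∧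
    skewDer ξ 1 (basisι k 0 * t) = -(basisι k 0 * skewDer ξ 1 t) := by
  -- Stated for any `z` in place of `Δ(t)`, so that linearity reduces it to pure tensors.
  have key : ∀ z,
      contract (degreeOneCoord k 0)
        ((V33 ξ).braidedMul (basisι k 0 ⊗ₜ 1 + 1 ⊗ₜ basisι k 0) z) =
        contract (augment k) z - ξ • (basisι k 0 * contract (degreeOneCoord k 0) z) -
          (1 + ξ) • (basisι k 1 * contract (degreeOneCoord k 1) z) ∧
      contract (degreeOneCoord k 1)
        ((V33 ξ).braidedMul (basisι k 0 ⊗ₜ 1 + 1 ⊗ₜ basisι k 0) z) =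
        -(basisι k 0 * contract (degreeOneCoord k 1) z) := by
    intro z
    induction z with
    | zero => simp
    | add z w hz hw =>
      simp only [map_add _ z w]
      simp only [map_add (contract (degreeOneCoord k _)), hz.1, hz.2, hw.1, hw.2, mul_add]
      constructor <;> module
    | tmul r s =>
      rw [braidedMul_basisι_zero]
      simp only [map_add, map_smul, contract_tmul, degreeOneCoord_tensorAct,
        degreeOneCoord_basisι_mul]
      simp only [actMatrix, Matrix.of_apply, Matrix.cons_val_zero, Matrix.cons_val_one, map_neg,
        map_smul, map_zero, degreeOneCoord_basisι, mul_smul_comm]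
      constructor <;> simp <;> module
  simpa only [skewDer, LinearMap.comp_apply, braidedComul_ι_mul, contract_augment_braidedComul]
    using key ((V33 ξ).braidedComul t)

lemma skewDer_basisι_one_mul (t : TensorAlgebra k (Fin 2 → k)) :
    skewDer ξ 0 (basisι k 1 * t) =
      ξ • (basisι k 1 * skewDer ξ 0 t) + ((1 - ξ) / 2) • (basisι k 0 * skewDer ξ 1 t) ∧
    skewDer ξ 1 (basisι k 1 * t) = t - basisι k 1 * skewDer ξ 1 t := by
  have key : ∀ z,
      contract (degreeOneCoord k 0)
        ((V33 ξ).braidedMul (basisι k 1 ⊗ₜ 1 + 1 ⊗ₜ basisι k 1) z) =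
        ξ • (basisι k 1 * contract (degreeOneCoord k 0) z) +
          ((1 - ξ) / 2) • (basisι k 0 * contract (degreeOneCoord k 1) z) ∧
      contract (degreeOneCoord k 1)
        ((V33 ξ).braidedMul (basisι k 1 ⊗ₜ 1 + 1 ⊗ₜ basisι k 1) z) =
        contract (augment k) z - basisι k 1 * contract (degreeOneCoord k 1) z := by
    intro z
    induction z with
    | zero => simp
    | add z w hz hw =>
      simp only [map_add _ z w]
      simp only [map_add (contract (degreeOneCoord k _)), hz.1, hz.2, hw.1, hw.2, mul_add]
      constructor <;> module
    | tmul r s =>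
      rw [braidedMul_basisι_one]
      simp only [map_add, map_smul, contract_tmul, degreeOneCoord_tensorAct,
        degreeOneCoord_basisι_mul]
      simp only [actMatrix, Matrix.of_apply, Matrix.cons_val_zero, Matrix.cons_val_one, map_neg,
        map_smul, map_zero, degreeOneCoord_basisι, mul_smul_comm]
      constructor <;> simp <;> module
  simpa only [skewDer, LinearMap.comp_apply, braidedComul_ι_mul, contract_augment_braidedComul]
    using key ((V33 ξ).braidedComul t)

/-- A linear map vanishing on the kernel of a surjective one factors through it. -/
lemma exists_comp_eq_of_ker_le {V W U : Type*} [AddCommGroup V] [Module k V] [AddCommGroup W]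
    [Module k W] [AddCommGroup U] [Module k U] {π : V →ₗ[k] W} (hπ : Function.Surjective π)
    {g : V →ₗ[k] U} (h : LinearMap.ker π ≤ LinearMap.ker g) :
    ∃ g' : W →ₗ[k] U, ∀ v, g' (π v) = g v := by
  obtain ⟨s, hs⟩ := π.exists_rightInverse_of_surjective (LinearMap.range_eq_top.2 hπ)
  refine ⟨g ∘ₗ s, fun v => ?_⟩
  have hv : s (π v) - v ∈ LinearMap.ker g := h (by
    rw [LinearMap.mem_ker, map_sub, sub_eq_zero]
    exact LinearMap.congr_fun hs (π v))
  rwa [LinearMap.mem_ker, map_sub, sub_eq_zero] at hv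

lemma linearIndependent_nichols (h2 : (2 : k) ≠ 0) :
    LinearIndependent k (monomials ((V33 ξ).nicholsι (Pi.single 0 1))
      ((V33 ξ).nicholsι (Pi.single 1 1))) := by
  let π := Ideal.Quotient.mkₐ k (TwoSidedIdeal.asIdeal (V33 ξ).nicholsIdeal)
  have hπ : Function.Surjective π := Ideal.Quotient.mkₐ_surjective k _
  have hker : ∀ t, π t = 0 ↔ t ∈ (V33 ξ).nicholsIdeal := fun t => Ideal.Quotient.eq_zero_iff_mem
  have hrel : relationIdeal (basisι k 0) (basisι k 1) ≤ TwoSidedIdeal.ker π := fun t ht =>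
    (TwoSidedIdeal.mem_ker π).2 ((hker t).2
      ((V33 ξ).isGreatest_nicholsIdeal.2 (relationIdeal_mem_coidealIdeals ξ h2) ht))
  obtain ⟨hxx, hyx, -⟩ := relations_of_relationIdeal_le_ker π hrel
  have htriv : ∀ t ∈ (V33 ξ).nicholsIdeal,
      TensorAlgebra.toTrivSqZeroExt (R := k) (M := Fin 2 → k) t = 0 := fun t ht =>
    (TwoSidedIdeal.mem_ker _).1 ((V33 ξ).nicholsIdeal_le_ker_toTrivSqZeroExt ht)
  obtain ⟨ε, hε⟩ := exists_comp_eq_of_ker_le (π := π.toLinearMap) hπ (g := augment k)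
    fun t ht => by simp [augment, htriv t ((hker t).1 ht)]
  -- Contraction maps the coideal into itself because the degree-one coordinate vanishes on it,
  -- hence each skew derivation descends.
  have hd : ∀ i, ∃ d : _ →ₗ[k] _, ∀ t, d (π.toLinearMap t) = (π.toLinearMap ∘ₗ skewDer ξ i) t :=
    fun i =>
    exists_comp_eq_of_ker_le (π := π.toLinearMap) (g := π.toLinearMap ∘ₗ skewDer ξ i) hπ
      fun t ht =>
      (hker _).2 (contract_braidedComul_mem _ (fun s hs => by simp [degreeOneCoord, htriv s hs])
        ((hker t).1 ht))
  obtain ⟨d₀, hd₀⟩ := hd 0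
  obtain ⟨d₁, hd₁⟩ := hd 1
  simp only [AlgHom.toLinearMap_apply, LinearMap.comp_apply] at hε hd₀ hd₁
  refine linearIndependent_monomials (x := π (basisι k 0)) (y := π (basisι k 1)) h2
    (xi_mul_xi hξ.out) hxx hyx ε d₀ d₁ ?_ ?_ ?_ ?_ ?_ ?_ ?_ ?_ ?_
  · rw [← map_one π, hε, augment_one]
  · exact hπ.forall.2 fun t => by rw [← map_mul, hε, augment_basisι_mul]
  · exact hπ.forall.2 fun t => by rw [← map_mul, hε, augment_basisι_mul]
  · rw [← map_one π, hd₀, skewDer_one, map_zero]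
  · rw [← map_one π, hd₁, skewDer_one, map_zero]
  · refine hπ.forall.2 fun t => ?_
    rw [← map_mul, hd₀, hd₀, hd₁, (skewDer_basisι_zero_mul ξ t).1]
    simp only [map_sub, map_smul, map_mul]
  · refine hπ.forall.2 fun t => ?_
    rw [← map_mul, hd₁, hd₁, (skewDer_basisι_zero_mul ξ t).2, map_neg, map_mul]
  · refine hπ.forall.2 fun t => ?_
    rw [← map_mul, hd₀, hd₀, hd₁, (skewDer_basisι_one_mul ξ t).1]
    simp only [map_add, map_smul, map_mul]
  · refine hπ.forall.2 fun t => ?_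
    rw [← map_mul, hd₁, hd₁, (skewDer_basisι_one_mul ξ t).2, map_sub, map_mul]

end KHopf

end

/-! ### The presentation and the dimension -/

theorem mainTheorem10 {k : Type*} [Field k] [IsAlgClosed k] [CharZero k]
    (ξ : k) [Fact (IsPrimitiveRoot ξ 4)] :
    let B := (KHopf.V33 ξ).NicholsAlgebra
    let x : FreeAlgebra k (Fin 2) := FreeAlgebra.ι k 0
    let y : FreeAlgebra k (Fin 2) := FreeAlgebra.ι k 1
    let φ : FreeAlgebra k (Fin 2) →ₐ[k] B :=
      FreeAlgebra.lift k fun i => (KHopf.V33 ξ).nicholsι (Pi.single i 1)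
    Function.Surjective φ ∧
      TwoSidedIdeal.ker φ =
        TwoSidedIdeal.span {x ^ 2 - 2 * y ^ 2, x * y + y * x, y ^ 4} ∧
      Module.finrank k B = 8 := by
  intro B x y φ
  have h2 : (2 : k) ≠ 0 := two_ne_zero
  let π := Ideal.Quotient.mkₐ k (TwoSidedIdeal.asIdeal (KHopf.V33 ξ).nicholsIdeal)
  have hπ : Function.Surjective π := Ideal.Quotient.mkₐ_surjective k _
  have hrel : KHopf.relationIdeal (KHopf.basisι k 0) (KHopf.basisι k 1) ≤ TwoSidedIdeal.ker π :=
    fun t ht => (TwoSidedIdeal.mem_ker π).2 (Ideal.Quotient.eq_zero_iff_mem.2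
      ((KHopf.V33 ξ).isGreatest_nicholsIdeal.2
        (KHopf.relationIdeal_mem_coidealIdeals ξ h2) ht))
  obtain ⟨hxx, hyx, hy4⟩ := KHopf.relations_of_relationIdeal_le_ker π hrel
  have hx : φ x = π (KHopf.basisι k 0) := FreeAlgebra.lift_ι_apply _ _
  have hy : φ y = π (KHopf.basisι k 1) := FreeAlgebra.lift_ι_apply _ _
  have hgen : Algebra.adjoin k {φ x, φ y} = ⊤ := by
    rw [hx, hy]
    exact KHopf.map_adjoin_eq_top hπ
  rw [← hx, ← hy] at hxx hyx
  rw [← hy] at hy4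
  have hli : LinearIndependent k (KHopf.monomials (φ x) (φ y)) := by
    rw [hx, hy]
    exact KHopf.linearIndependent_nichols ξ h2
  have hspan := KHopf.span_monomials hgen hxx hyx hy4
  have hsurj : Function.Surjective φ := by
    rw [← AlgHom.range_eq_top, eq_top_iff, ← hgen, Algebra.adjoin_le_iff]
    rintro _ (rfl | rfl)
    exacts [⟨x, rfl⟩, ⟨y, rfl⟩]
  refine ⟨hsurj, le_antisymm ?_ (KHopf.relationIdeal_le_ker φ hxx hyx hy4), ?_⟩
  · change _ ≤ KHopf.relationIdeal x y
    intro t ht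
    let q := Ideal.Quotient.mkₐ k (TwoSidedIdeal.asIdeal (KHopf.relationIdeal x y))
    have hq : Function.Surjective q := Ideal.Quotient.mkₐ_surjective k _
    have hqker : ∀ t, q t = 0 ↔ t ∈ KHopf.relationIdeal x y := fun t =>
      Ideal.Quotient.eq_zero_iff_mem
    obtain ⟨gxx, gyx, gy4⟩ := KHopf.relations_of_relationIdeal_le_ker q
      fun t ht => (TwoSidedIdeal.mem_ker q).2 ((hqker t).2 ht)
    have hfree : Algebra.adjoin k {x, y} = ⊤ := by
      rw [← FreeAlgebra.adjoin_range_ι]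
      congr 1
      ext t
      simp [Fin.exists_fin_two, x, y, eq_comm]
    have hqgen : Algebra.adjoin k {q x, q y} = ⊤ := by
      rw [← Set.image_pair, ← AlgHom.map_adjoin, hfree, Algebra.map_top]
      exact (AlgHom.range_eq_top q).2 hq
    have hmem : q t ∈ Submodule.span k (Set.range (KHopf.monomials (q x) (q y))) := by
      rw [KHopf.span_monomials hqgen gxx gyx gy4]
      exact Submodule.mem_top
    -- Modulo the relations, `t` is a combination of the eight monomials. As `φ t = 0`, independence
    -- in the Nichols algebra makes all coefficients zero, leaving `t` in the relation ideal.
    obtain ⟨c, hc⟩ := (Submodule.mem_span_range_iff_exists_fun k).1 hmem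
    have hdiff : t - ∑ p, c p • KHopf.monomials x y p ∈ KHopf.relationIdeal x y := by
      rw [← hqker, map_sub, ← hc, map_sum, sub_eq_zero]
      simp [KHopf.monomials]
    have hφ := (TwoSidedIdeal.mem_ker φ).1 (KHopf.relationIdeal_le_ker φ hxx hyx hy4 hdiff)
    rw [map_sub, (TwoSidedIdeal.mem_ker φ).1 ht, zero_sub, neg_eq_zero, map_sum] at hφ
    have hc0 := Fintype.linearIndependent_iff.1 hli c (by simpa [KHopf.monomials] using hφ)
    simpa [hc0] using hdiff
  · have h := Module.finrank_eq_card_basis (Module.Basis.mk hli hspan.ge)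
    simpa using h
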